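/- Let $g,n\ge 0$ be integers with $2g-2+n>0$, let $d\in\mathbb Z$, let $[n]=\{1,\dots,n\}$, and let $\delta=\delta_{1,g}$ be $1$ if $g=1$ and $0$ otherwise. **Stability space.** An $n$-marked graph $\Gamma$ is a finite graph (loops and multiple edges allowed) with a genus $g(v)\in\mathbb N$ at each vertex and a map $[n]\to\mathrm{Vert}(\Gamma)$ placing the markings; its genus is $\sum_v g(v)-\#\mathrm{Vert}(\Gamma)+\#\mathrm{Edge}(\Gamma)+1$. It is stable if it is connected and each vertex $v$ with $g(v)=0$ satisfies $\mathrm{val}(v)+\#\{\text{markings on }v\}\ge 3$, where $\mathrm{val}(v)$ is the number of half-edges at $v$. A contraction $c\colon\Gamma\to\Gamma'$ contracts one edge $e$, followed by an isomorphism; the resulting vertex has as genus the sum of the genera of the two ends of $e$, or the genus of its end plus $1$ if $e$ is a loop. Let $V^d_{g,n}$ be the affine space of families $\phi=(\phi(\Gamma))_\Gamma$, over all stable $n$-marked graphs $\Gamma$ of genus $g$, of functions $\phi(\Gamma)\colon\mathrm{Vert}(\Gamma)\to\mathbb R$ with $\sum_v\phi(\Gamma)(v)=d$ that are invariant under isomorphisms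 and satisfy $\phi(\Gamma')(w)=\sum_{c(v)=w}\phi(\Gamma)(v)$ for all contractions $c\colon\Gamma\to\Gamma'$ and vertices $w$ of $\Gamma'$; it has the topology of pointwise convergence. The canonical parameter is $\phi^d_{\rm can}(\Gamma)(v)=\frac{d}{2g-2}\,(2g(v)-2+\mathrm{val}(v))$ if $g\ge2$; if $g\le 1$, it is $d$ when the marking $1$ lies on $v$, and $0$ otherwise. **Stability subspaces.** Let $\Gamma$ be a stable $n$-marked graph of genus $g$, let $\emptyset\subsetneq\Gamma_0\subsetneq\Gamma$ be an elementary complete subgraph (meaning that $\Gamma_0$ and its complement $\Gamma_0^c$ are both connected), and let $k\in\mathbb Z$. The corresponding stability subspace is $$H(\Gamma,\Gamma_0,k)=\Big\{\phi\in V^d_{g,n}:\ k-\sum_{v\in\Gamma_0}\phi(\Gamma)(v)+\tfrac12\#(\Gamma_0\cap\Gamma_0^c)=0\Big\},$$ where $\Gamma_0\cap\Gamma_0^c$ is the set of edges joining $\Gamma_0$ to $\Gamma_0^c$. A stability polytope is a connected component of the complement in $V^d_{g,n}$ of the union of all stability subspaces. **The spaces $C_{g,n}$ and $D_{g,n}$.**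 Let $(i,S)$ range over the pairs with $0\le i\le g$, $S\subseteq[n]$, $|S|\ge2$ if $i=0$, $|S|\le n-2$ if $i=g$, and moreover $i<g-i$ if $n=0$, and $1\in S$ if $n\ge1$. Let $\Gamma(i,S)$ be the graph with a first vertex of genus $i$ with markings $S$ and a second vertex of genus $g-i$ with the other markings, joined by one edge. For $g\ge1$ and $1+\delta\le j\le n$, let $\Gamma_j$ be the graph with a first vertex of genus $0$ with marking $j$ only and a second vertex of genus $g-1$ with the other markings, joined by two edges. Write $V^0(\Gamma)$ for the real functions on $\mathrm{Vert}(\Gamma)$ with sum $0$, and let $C_{g,n}=\bigoplus_{(i,S)}V^0(\Gamma(i,S))$ and $D_{g,n}=\bigoplus_jV^0(\Gamma_j)$ (so $D_{0,n}=0$). The values at the first vertices are coordinates $\alpha_{i,S}$ on $C_{g,n}$ and $x_j$ on $D_{g,n}$. For a set $S$ of indices, put $x_S=\sum_{j\in S}x_j$. Restricting $\phi-\phi^d_{\rm can}$ to the graphs $\Gamma(i,S)$, respectively $\Gamma_j$, defines maps $\pi_C\colon V^d_{g,n}\to C_{g,n}$ and $\pi_D\colon V^d_{g,n}\to D_{g,n}$.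 For $k\in\mathbb Z$ let $$W_C(i,S,k)=\Big\{\alpha_{i,S}=k-\tfrac{(2i-1)(d+1-g)}{2g-2}\Big\}\ (g\ge2),\qquad W_C(i,S,k)=\big\{\alpha_{i,S}=k-\tfrac12\big\}\ (g\le1),$$ and for $g\ge1$, integers $0\le\ell<2g-2+\delta$, $S\subseteq\{1+\delta,\dots,n\}$ with $(\ell,S)\neq(0,\emptyset)$, and $k\in\mathbb Z$, let $$W_D(\ell,S,k)=\Big\{x_S+\frac{\ell\,(d+1-g-x_{\{1+\delta,\dots,n\}})}{2g-2+\delta}=k\Big\}\subseteq D_{g,n}$$ (there are no $W_D$ for $g=0$). **Theorem.** We have $\phi^d_{\rm can}\in V^d_{g,n}$, and $(\pi_C,\pi_D)\colon V^d_{g,n}\to C_{g,n}\oplus D_{g,n}$ is an isomorphism of affine spaces. The stability subspaces of $V^d_{g,n}$ are exactly the sets $\pi_C^{-1}(W_C(i,S,k))$ and the sets $\pi_D^{-1}(W_D(\ell,S,k))$. Consequently, the stability polytopes are exactly the sets $\pi_C^{-1}(Q)\cap\pi_D^{-1}(R)$, where $Q$ is an open unit hypercube in the coordinates $\alpha_{i,S}$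 each of whose sides runs between two consecutive hyperplanes $W_C(i,S,k)$ and $W_C(i,S,k+1)$, and $R$ is a connected component of the complement in $D_{g,n}$ of the union of the $W_D(\ell,S,k)$. Each such $R$ is bounded and is the intersection of finitely many open affine half-spaces. For $g\ge1$, the collection of the $W_D(\ell,S,k)$ contains all integer translates $\{x_S=k\}$, $\emptyset\ne S\subseteq\{1+\delta,\dots,n\}$, of the resonance hyperplanes. -/

import Mathlib

noncomputable section

namespace UnivStab

/-! ### Marked graphs, isomorphisms, contractions -/

/-- A finite graph (with loops and multiple edges allowed) given by vertices, half-edges, the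
endpoint map and a fixed point free involution, with a genus map and `n` markings.
The marking called `j` in `{1, …, n}` is `⟨j - 1, _⟩ : Fin n`. -/
structure MarkedGraph (n : ℕ) where
  Vert : Type
  HalfEdge : Type
  vertFintype : Fintype Vert
  halfEdgeFintype : Fintype HalfEdge
  endpoint : HalfEdge → Vert
  inv : HalfEdge → HalfEdge
  inv_inv : ∀ h, inv (inv h) = h
  inv_ne : ∀ h, inv h ≠ h
  genus : Vert → ℕ
  marking : Fin n → Vert

attribute [instance] MarkedGraph.vertFintype MarkedGraph.halfEdgeFintype

namespace MarkedGraph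

variable {n : ℕ}

/-- Two half-edges are equivalent when they belong to the same edge. -/
def edgeSetoid (Γ : MarkedGraph n) : Setoid Γ.HalfEdge where
  r h h' := h' = h ∨ h' = Γ.inv h
  iseqv :=
    { refl := fun _ => Or.inl rfl
      symm := by
        rintro h h' (rfl | rfl)
        · exact Or.inl rfl
        · exact Or.inr (Γ.inv_inv h).symm
      trans := by
        rintro h h' h'' (rfl | rfl) (rfl | rfl)
        · exact Or.inl rfl
        · exact Or.inr rfl
        · exact Or.inr rfl
        · exact Or.inl (Γ.inv_inv h) }

/-- The edges: orbits of the involution on half-edges. -/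
abbrev Edge (Γ : MarkedGraph n) : Type := Quotient Γ.edgeSetoid

/-- The number of half-edges with endpoint `v` (a loop at `v` counts twice). -/
def valence (Γ : MarkedGraph n) (v : Γ.Vert) : ℕ := Nat.card {h : Γ.HalfEdge // Γ.endpoint h = v}

/-- The number of markings lying on `v`. -/
def numMarkings (Γ : MarkedGraph n) (v : Γ.Vert) : ℕ := Nat.card {j : Fin n // Γ.marking j = v}

/-- The simple graph underlying `Γ`: distinct vertices joined by at least one edge. -/
def adjGraph (Γ : MarkedGraph n) : SimpleGraph Γ.Vert where
  Adj v w := v ≠ w ∧ ∃ h, Γ.endpoint h = v ∧ Γ.endpoint (Γ.inv h) = w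
  symm := ⟨by
    rintro v w ⟨hne, h, rfl, rfl⟩
    exact ⟨hne.symm, Γ.inv h, rfl, by rw [Γ.inv_inv]⟩⟩
  loopless := ⟨fun _ h => h.1 rfl⟩

/-- Stable: connected, and every vertex of genus zero carries at least three special points. -/
def IsStable (Γ : MarkedGraph n) : Prop :=
  Γ.adjGraph.Connected ∧ ∀ v, Γ.genus v = 0 → 3 ≤ Γ.valence v + Γ.numMarkings v

/-- The arithmetic genus `∑ g(v) - #Vert + #Edge + 1`. -/
def arithGenus (Γ : MarkedGraph n) : ℤ :=
  ∑ v, (Γ.genus v : ℤ) - Fintype.card Γ.Vert + Nat.card Γ.Edge + 1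

/-- Isomorphisms of marked graphs. -/
structure Iso (Γ Γ' : MarkedGraph n) where
  vert : Γ.Vert ≃ Γ'.Vert
  half : Γ.HalfEdge ≃ Γ'.HalfEdge
  inv_comm : ∀ h, half (Γ.inv h) = Γ'.inv (half h)
  endpoint_comm : ∀ h, vert (Γ.endpoint h) = Γ'.endpoint (half h)
  genus_comm : ∀ v, Γ'.genus (vert v) = Γ.genus v
  marking_comm : ∀ j, vert (Γ.marking j) = Γ'.marking j

/-- The equivalence relation on vertices that identifies the two endpoints of the edge
`{h, inv h}` and nothing else. -/
def contractSetoid (Γ : MarkedGraph n) (h : Γ.HalfEdge) : Setoid Γ.Vert where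
  r v w := v = w ∨
    ((v = Γ.endpoint h ∨ v = Γ.endpoint (Γ.inv h)) ∧
      (w = Γ.endpoint h ∨ w = Γ.endpoint (Γ.inv h)))
  iseqv :=
    { refl := fun _ => Or.inl rfl
      symm := by
        rintro v w (rfl | ⟨hv, hw⟩)
        · exact Or.inl rfl
        · exact Or.inr ⟨hw, hv⟩
      trans := by
        rintro v w u (rfl | ⟨hv, hw⟩) (rfl | ⟨hw', hu⟩)
        · exact Or.inl rfl
        · exact Or.inr ⟨hw', hu⟩
        · exact Or.inr ⟨hv, hw⟩
        · exact Or.inr ⟨hv, hu⟩ }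

open Classical in
/-- The strict contraction of the edge `{h, inv h}`. The new vertex has genus `g(v₁) + g(v₂)` if
the edge is not a loop, and `g(v₁) + 1` if it is a loop; all other vertices keep their genus. -/
def contract (Γ : MarkedGraph n) (h : Γ.HalfEdge) : MarkedGraph n where
  Vert := Quotient (Γ.contractSetoid h)
  HalfEdge := {x : Γ.HalfEdge // x ≠ h ∧ x ≠ Γ.inv h}
  vertFintype := Fintype.ofFinite _
  halfEdgeFintype := Fintype.ofFinite _
  endpoint x := Quotient.mk _ (Γ.endpoint x.1)
  inv x := ⟨Γ.inv x.1,
    fun hx => x.2.2 ((Γ.inv_inv x.1).symm.trans (congrArg Γ.inv hx)),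
    fun hx => x.2.1 ((Γ.inv_inv x.1).symm.trans ((congrArg Γ.inv hx).trans (Γ.inv_inv h)))⟩
  inv_inv x := Subtype.ext (Γ.inv_inv x.1)
  inv_ne x hx := Γ.inv_ne x.1 (congrArg Subtype.val hx)
  genus q := (∑ v with Quotient.mk (Γ.contractSetoid h) v = q, Γ.genus v) +
    if Quotient.mk (Γ.contractSetoid h) (Γ.endpoint h) = q ∧
      Γ.endpoint h = Γ.endpoint (Γ.inv h) then 1 else 0
  marking j := Quotient.mk _ (Γ.marking j)

/-- A contraction `Γ → Γ'`: an edge of `Γ` and an isomorphism of the strict contraction of that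
edge with `Γ'`. -/
structure Contraction (Γ Γ' : MarkedGraph n) where
  edge : Γ.HalfEdge
  iso : Iso (Γ.contract edge) Γ'

/-- The map on vertices induced by a contraction. -/
def Contraction.vertMap {Γ Γ' : MarkedGraph n} (c : Contraction Γ Γ') (v : Γ.Vert) : Γ'.Vert :=
  c.iso.vert (Quotient.mk (Γ.contractSetoid c.edge) v)

/-- A subgraph is complete, hence given by its set of vertices `U`. It is elementary when it and
its complement are both connected (in particular both nonempty). -/
def IsElementary (Γ : MarkedGraph n) (U : Finset Γ.Vert) : Prop :=
  (Γ.adjGraph.induce (U : Set Γ.Vert)).Connected ∧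
    (Γ.adjGraph.induce ((U : Set Γ.Vert)ᶜ)).Connected

/-- The number of edges joining `U` to its complement; each of them has exactly one half-edge
whose endpoint lies in `U`. -/
def cutSize (Γ : MarkedGraph n) (U : Finset Γ.Vert) : ℕ :=
  Nat.card {h : Γ.HalfEdge // Γ.endpoint h ∈ U ∧ Γ.endpoint (Γ.inv h) ∉ U}

/-- `V⁰(Γ)`: real functions on the vertices with sum zero. -/
def degZero (Γ : MarkedGraph n) : Submodule ℝ (Γ.Vert → ℝ) where
  carrier := {φ | ∑ v, φ v = 0}
  add_mem' := by
    intro a b ha hb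
    simp only [Set.mem_ofPred_eq, Pi.add_apply, Finset.sum_add_distrib] at *
    rw [ha, hb, add_zero]
  zero_mem' := by simp
  smul_mem' := by
    intro c a ha
    simp only [Set.mem_ofPred_eq, Pi.smul_apply, smul_eq_mul, ← Finset.mul_sum] at *
    rw [ha, mul_zero]

theorem two_mul_card_edge (Γ : MarkedGraph n) :
    2 * Nat.card Γ.Edge = Fintype.card Γ.HalfEdge := by
  classical
  have : Fintype Γ.Edge := Fintype.ofFinite _
  rw [Nat.card_eq_fintype_card]
  have h := Finset.card_eq_sum_card_fiberwise (s := (Finset.univ : Finset Γ.HalfEdge))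
    (t := (Finset.univ : Finset Γ.Edge)) (f := fun h => Quotient.mk Γ.edgeSetoid h)
    (fun _ _ => Finset.mem_coe.2 (Finset.mem_univ _))
  rw [← Finset.card_univ (α := Γ.HalfEdge), h, Finset.sum_const_nat (m := 2), Finset.card_univ,
    mul_comm]
  intro q _
  induction q using Quotient.inductionOn with
  | h x =>
    have : (Finset.univ.filter fun y => Quotient.mk Γ.edgeSetoid y = Quotient.mk Γ.edgeSetoid x)
        = {x, Γ.inv x} := by
      ext y
      simp only [Finset.mem_filter, Finset.mem_univ, true_and, Finset.mem_insert,
        Finset.mem_singleton]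
      constructor
      · intro hy
        exact (Quotient.exact hy.symm : y = x ∨ y = Γ.inv x)
      · intro hy
        exact (Quotient.sound (show y = x ∨ y = Γ.inv x from hy)).symm
    rw [this, Finset.card_pair (Γ.inv_ne x).symm]

theorem sum_valence (Γ : MarkedGraph n) :
    ∑ v, Γ.valence v = Fintype.card Γ.HalfEdge := by
  classical
  simp only [valence, Nat.card_eq_fintype_card]
  rw [← Fintype.card_sigma]
  exact Fintype.card_congr (Equiv.sigmaFiberEquiv Γ.endpoint)

/-! ### Vine graphs -/

/-- The loopless graph with two vertices, the first one (`true`) of genus `i` carrying the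
markings in `S`, the second one (`false`) of genus `j` carrying the other markings, joined by
`α` edges. -/
def vine (α i j : ℕ) (S : Finset (Fin n)) : MarkedGraph n where
  Vert := Bool
  HalfEdge := Bool × Fin α
  vertFintype := inferInstance
  halfEdgeFintype := inferInstance
  endpoint := Prod.fst
  inv h := (!h.1, h.2)
  inv_inv h := by simp
  inv_ne h hh := by simpa using congrArg Prod.fst hh
  genus b := if b then i else j
  marking k := decide (k ∈ S)

theorem vine_valence (α i j : ℕ) (S : Finset (Fin n)) (b : Bool) :
    (vine α i j S).valence b = α := by
  have e : {h : Bool × Fin α // h.1 = b} ≃ Fin α :=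
    { toFun := fun h => h.1.2
      invFun := fun k => ⟨(b, k), rfl⟩
      left_inv := by rintro ⟨⟨c, k⟩, rfl⟩; rfl
      right_inv := fun _ => rfl }
  exact (Nat.card_congr e).trans (Nat.card_fin α)

theorem vine_numMarkings_true (α i j : ℕ) (S : Finset (Fin n)) :
    (vine α i j S).numMarkings true = S.card := by
  have e : {k : Fin n // decide (k ∈ S) = true} ≃ {k : Fin n // k ∈ S} :=
    Equiv.subtypeEquivRight fun k => by simp
  exact (Nat.card_congr e).trans (by simp)

theorem vine_numMarkings_false (α i j : ℕ) (S : Finset (Fin n)) :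
    (vine α i j S).numMarkings false = n - S.card := by
  have e : {k : Fin n // decide (k ∈ S) = false} ≃ {k : Fin n // k ∈ Sᶜ} :=
    Equiv.subtypeEquivRight fun k => by simp
  exact (Nat.card_congr e).trans (by simp)

theorem vine_isStable (α i j : ℕ) (S : Finset (Fin n)) (hα : 1 ≤ α)
    (hi : i = 0 → 3 ≤ α + S.card) (hj : j = 0 → 3 ≤ α + (n - S.card)) :
    (vine α i j S).IsStable := by
  refine ⟨?_, ?_⟩
  · have hadj : ∀ b : Bool, (vine α i j S).adjGraph.Adj b (!b) := fun b =>
      ⟨(Bool.not_ne_self b).symm, (b, ⟨0, hα⟩), rfl, rfl⟩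
    have : Nonempty (vine α i j S).Vert := ⟨(true : Bool)⟩
    refine SimpleGraph.Connected.mk ?_
    intro b c
    by_cases hbc : b = c
    · subst hbc
      exact SimpleGraph.Reachable.refl _
    · have : c = (!b : Bool) := by
        exact (Bool.eq_not.2 (Ne.symm hbc))
      rw [this]
      exact (hadj b).reachable
  · have key : ∀ b : Bool, (if b then i else j) = 0 →
        3 ≤ (vine α i j S).valence b + (vine α i j S).numMarkings b := by
      intro b hb
      rw [vine_valence]
      cases b
      · rw [vine_numMarkings_false]
        exact hj hb
      · rw [vine_numMarkings_true]
        exact hi hb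
    exact key

theorem vine_arithGenus (α i j : ℕ) (S : Finset (Fin n)) :
    (vine α i j S).arithGenus = i + j + α - 1 := by
  have h := two_mul_card_edge (vine α i j S)
  have h1 : Fintype.card (vine α i j S).HalfEdge = 2 * α := by
    change Fintype.card (Bool × Fin α) = 2 * α
    simp
  have h2 : Fintype.card (vine α i j S).Vert = 2 := Fintype.card_bool
  have h3 : ∑ v, ((vine α i j S).genus v : ℤ) = i + j := by
    change ∑ v : Bool, ((if v then i else j : ℕ) : ℤ) = i + j
    simp
  have h4 : Nat.card (vine α i j S).Edge = α := by omega
  rw [arithGenus, h2, h3, h4]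
  push_cast
  ring

end MarkedGraph

/-! ### The universal stability space -/

/-- Stable `n`-marked graphs of genus `g`. -/
abbrev StableGraph (g n : ℕ) : Type 1 :=
  {Γ : MarkedGraph n // Γ.IsStable ∧ Γ.arithGenus = g}

/-- Vectors assigning to every stable graph a real function on its vertices. -/
abbrev Family (g n : ℕ) : Type 1 := ∀ Γ : StableGraph g n, Γ.1.Vert → ℝ

/-- Invariance under isomorphisms. A family on one representative per isomorphism class which is
invariant under automorphisms is the same as a family on all stable graphs which is invariant
under isomorphisms. -/
def IsoInvariant {g n : ℕ} (φ : Family g n) : Prop :=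
  ∀ (Γ Γ' : StableGraph g n) (f : MarkedGraph.Iso Γ.1 Γ'.1) (v : Γ.1.Vert),
    φ Γ' (f.vert v) = φ Γ v

open Classical in
/-- Compatibility with all contractions. -/
def ContractionCompatible {g n : ℕ} (φ : Family g n) : Prop :=
  ∀ (Γ Γ' : StableGraph g n) (c : MarkedGraph.Contraction Γ.1 Γ'.1) (w : Γ'.1.Vert),
    φ Γ' w = ∑ v with c.vertMap v = w, φ Γ v

/-- The stability space `V_{g,n}`. -/
def stabSpace (g n : ℕ) : Submodule ℝ (Family g n) where
  carrier := {φ | IsoInvariant φ ∧ ContractionCompatible φ}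
  add_mem' := by
    rintro a b ⟨ha, ha'⟩ ⟨hb, hb'⟩
    refine ⟨fun Γ Γ' f v => ?_, fun Γ Γ' c w => ?_⟩
    · simp only [Pi.add_apply, ha Γ Γ' f v, hb Γ Γ' f v]
    · simp only [Pi.add_apply, ha' Γ Γ' c w, hb' Γ Γ' c w, Finset.sum_add_distrib]
  zero_mem' := ⟨fun _ _ _ _ => rfl, fun _ _ _ _ => by simp⟩
  smul_mem' := by
    rintro r a ⟨ha, ha'⟩
    refine ⟨fun Γ Γ' f v => ?_, fun Γ Γ' c w => ?_⟩
    · simp only [Pi.smul_apply, ha Γ Γ' f v]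
    · simp only [Pi.smul_apply, smul_eq_mul, ha' Γ Γ' c w, Finset.mul_sum]

/-- The affine subspace `V^d_{g,n}` of vectors of total degree `d` on every graph. -/
def stabSpaceDeg (g n : ℕ) (d : ℝ) : AffineSubspace ℝ (Family g n) where
  carrier := {φ | φ ∈ stabSpace g n ∧ ∀ Γ : StableGraph g n, ∑ v, φ Γ v = d}
  smul_vsub_vadd_mem' := by
    rintro c p₁ p₂ p₃ ⟨h₁, h₁'⟩ ⟨h₂, h₂'⟩ ⟨h₃, h₃'⟩
    refine ⟨?_, fun Γ => ?_⟩
    · simp only [vsub_eq_sub, vadd_eq_add]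
      exact add_mem (Submodule.smul_mem _ _ (sub_mem h₁ h₂)) h₃
    · simp only [vsub_eq_sub, vadd_eq_add, Pi.add_apply, Pi.smul_apply, Pi.sub_apply,
        smul_eq_mul, Finset.sum_add_distrib, ← Finset.mul_sum, Finset.sum_sub_distrib]
      rw [h₁', h₂', h₃']
      ring

open Classical in
/-- The canonical parameter: for `g ≥ 2` it is `d / (2g - 2)` times the multidegree
`v ↦ 2 g(v) - 2 + val(v)` of the dualizing sheaf, for `g ≤ 1` it is `d` times the multidegree of
the first section. -/
def canonicalParam (g n : ℕ) (d : ℝ) : Family g n := fun Γ v =>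
  if 2 ≤ g then d / (2 * g - 2) * (2 * (Γ.1.genus v : ℝ) - 2 + Γ.1.valence v)
  else if ∃ h : 0 < n, Γ.1.marking ⟨0, h⟩ = v then d else 0

theorem sum_canonicalParam {g n : ℕ} (hgn : 2 ≤ g ∨ 0 < n) (d : ℝ) (Γ : StableGraph g n) :
    ∑ v, canonicalParam g n d Γ v = d := by
  classical
  by_cases hg : 2 ≤ g
  · simp only [canonicalParam, if_pos hg]
    rw [← Finset.mul_sum]
    have h1 := Γ.1.two_mul_card_edge
    have h2 := Γ.1.sum_valence
    have h3 := Γ.2.2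
    rw [MarkedGraph.arithGenus] at h3
    have h1' : (2 : ℝ) * Nat.card Γ.1.Edge = Fintype.card Γ.1.HalfEdge := by exact_mod_cast h1
    have h2' : ∑ v, (Γ.1.valence v : ℝ) = Fintype.card Γ.1.HalfEdge := by exact_mod_cast h2
    have h3' : ∑ v, (Γ.1.genus v : ℝ) - Fintype.card Γ.1.Vert + Nat.card Γ.1.Edge + 1 = g := by
      exact_mod_cast h3
    have h4 : ∑ v, (2 * (Γ.1.genus v : ℝ) - 2 + Γ.1.valence v) = 2 * g - 2 := by
      rw [Finset.sum_add_distrib, Finset.sum_sub_distrib, ← Finset.mul_sum, h2', Finset.sum_const,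
        Finset.card_univ, nsmul_eq_mul]
      linarith
    rw [h4]
    have : (2 : ℝ) * g - 2 ≠ 0 := by
      have : (2 : ℝ) ≤ g := by exact_mod_cast hg
      linarith
    exact div_mul_cancel₀ d this
  · have hn : 0 < n := hgn.resolve_left hg
    simp only [canonicalParam, if_neg hg, hn, exists_true_left]
    simp

/-! ### The spaces `C_{g,n}` and `D_{g,n}` -/

/-- The pairs `(i, S)` indexing the boundary divisors of curves with a separating node. -/
abbrev SepIndex (g n : ℕ) : Type :=
  {p : Fin (g + 1) × Finset (Fin n) //
    (p.1.val = 0 → 2 ≤ p.2.card) ∧ (p.1.val = g → p.2.card + 2 ≤ n) ∧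
    (n = 0 → p.1.val < g - p.1.val) ∧ (∀ h : 0 < n, (⟨0, h⟩ : Fin n) ∈ p.2)}

/-- The graph `Γ(i, S)`: two vertices of genera `i` and `g - i` joined by one edge. -/
def sepGraph {g n : ℕ} (p : SepIndex g n) : StableGraph g n :=
  ⟨MarkedGraph.vine 1 p.1.1.val (g - p.1.1.val) p.1.2, by
    have hlt := p.1.1.isLt
    have hcard := Finset.card_le_univ p.1.2
    rw [Fintype.card_fin] at hcard
    refine ⟨MarkedGraph.vine_isStable _ _ _ _ le_rfl (fun h => ?_) (fun h => ?_), ?_⟩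
    · have := p.2.1 h
      omega
    · have := p.2.2.1 (by omega)
      omega
    · rw [MarkedGraph.vine_arithGenus]
      omega⟩

/-- The indices `j = 1 + δ_{1,g}, …, n` (none when `g = 0`); the index `1` is `0 : Fin n`. -/
abbrev LoopIndex (g n : ℕ) : Type := {j : Fin n // 1 ≤ g ∧ (g = 1 → j.val ≠ 0)}

/-- The graph `Γ_j`: two vertices of genera `0` and `g - 1` joined by two edges, the first of
them carrying exactly the marking `j`. -/
def loopGraph {g n : ℕ} (j : LoopIndex g n) : StableGraph g n :=
  ⟨MarkedGraph.vine 2 0 (g - 1) {j.1}, by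
    have hg := j.2.1
    have hj := j.1.isLt
    refine ⟨MarkedGraph.vine_isStable _ _ _ _ (by omega) (fun _ => by simp) (fun h => ?_), ?_⟩
    · have := j.2.2 (by omega)
      rw [Finset.card_singleton]
      omega
    · rw [MarkedGraph.vine_arithGenus]
      omega⟩

/-- `C_{g,n}`, the direct sum of the `V⁰(Γ(i, S))`. -/
abbrev CSpace (g n : ℕ) : Type := ∀ p : SepIndex g n, (sepGraph p).1.degZero

/-- `D_{g,n}`, the direct sum of the `V⁰(Γ_j)`. -/
abbrev DSpace (g n : ℕ) : Type := ∀ j : LoopIndex g n, (loopGraph j).1.degZero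

/-- The coordinate `α_{i,S}` on `C_{g,n}`: the value at the first vertex of `Γ(i, S)`. -/
def alpha {g n : ℕ} (p : SepIndex g n) (ψ : CSpace g n) : ℝ := (ψ p).1 true

/-- The coordinate `x_j` on `D_{g,n}`: the value at the first vertex of `Γ_j`. -/
def xcoord {g n : ℕ} (j : LoopIndex g n) (ψ : DSpace g n) : ℝ := (ψ j).1 true

/-- The projection `V^d_{g,n} → C_{g,n}`, `φ ↦ φ - φ_can` restricted to the graphs `Γ(i, S)`. -/
def toC {g n : ℕ} {d : ℝ} (φ : stabSpaceDeg g n d) : CSpace g n := fun p =>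
  ⟨φ.1 (sepGraph p) - canonicalParam g n d (sepGraph p), by
    have h : 2 ≤ g ∨ 0 < n := by
      by_contra hcon
      have hn : n = 0 := by omega
      have h1 := p.2.1
      have h2 := p.2.2.2.1 hn
      have h3 := Finset.card_le_univ p.1.2
      rw [Fintype.card_fin] at h3
      omega
    change ∑ v, (φ.1 (sepGraph p) v - canonicalParam g n d (sepGraph p) v) = 0
    rw [Finset.sum_sub_distrib, φ.2.2, sum_canonicalParam h, sub_self]⟩

/-- The projection `V^d_{g,n} → D_{g,n}`, `φ ↦ φ - φ_can` restricted to the graphs `Γ_j`. -/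
def toD {g n : ℕ} {d : ℝ} (φ : stabSpaceDeg g n d) : DSpace g n := fun j =>
  ⟨φ.1 (loopGraph j) - canonicalParam g n d (loopGraph j), by
    have h : 2 ≤ g ∨ 0 < n := Or.inr (lt_of_le_of_lt (Nat.zero_le _) j.1.isLt)
    change ∑ v, (φ.1 (loopGraph j) v - canonicalParam g n d (loopGraph j) v) = 0
    rw [Finset.sum_sub_distrib, φ.2.2, sum_canonicalParam h, sub_self]⟩

/-! ### Stability subspaces and polytopes -/

/-- The stability subspace `H(Γ, Γ₀, k)` of `V^d_{g,n}`, where `Γ₀` has vertex set `U`. -/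
def stabSubspace {g n : ℕ} (d : ℝ) (Γ : StableGraph g n) (U : Finset Γ.1.Vert) (k : ℤ) :
    Set (stabSpaceDeg g n d) :=
  {φ | (k : ℝ) - ∑ v ∈ U, φ.1 Γ v + (Γ.1.cutSize U : ℝ) / 2 = 0}

/-- The collection of all stability subspaces of `V^d_{g,n}`. -/
def stabSubspaces (g n : ℕ) (d : ℝ) : Set (Set (stabSpaceDeg g n d)) :=
  {X | ∃ (Γ : StableGraph g n) (U : Finset Γ.1.Vert) (k : ℤ),
    Γ.1.IsElementary U ∧ X = stabSubspace d Γ U k}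

/-- The connected components of the complement of the union of a collection of subsets. -/
def chambers {X : Type*} [TopologicalSpace X] (A : Set (Set X)) : Set (Set X) :=
  {Q | ∃ x ∈ (⋃₀ A)ᶜ, Q = connectedComponentIn (⋃₀ A)ᶜ x}

/-- The stability polytopes of `V^d_{g,n}`. -/
def stabPolytopes (g n : ℕ) (d : ℝ) : Set (Set (stabSpaceDeg g n d)) :=
  chambers (stabSubspaces g n d)

/-- The value of `α_{i,S}` on the hyperplane `W_C(i, S, k)`. -/
def wallLevelC (g : ℕ) (d : ℝ) (i : ℕ) (k : ℤ) : ℝ :=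
  if 2 ≤ g then k - (2 * i - 1) * (d + 1 - g) / (2 * g - 2) else k - 1 / 2

/-- The hyperplane `W_C(i, S, k)` of `C_{g,n}`, with `p = (i, S)`. -/
def wallC {g n : ℕ} (d : ℝ) (p : SepIndex g n) (k : ℤ) : Set (CSpace g n) :=
  {ψ | alpha p ψ = wallLevelC g d p.1.1.val k}

/-- The Kronecker delta `δ_{1,g}`. -/
def delta (g : ℕ) : ℕ := if g = 1 then 1 else 0

/-- The left-hand side of the equation of `W_D(ℓ, S, k)`. -/
def wallFunD {g n : ℕ} (d : ℝ) (ℓ : ℕ) (S : Finset (LoopIndex g n)) (x : DSpace g n) : ℝ :=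
  ∑ j ∈ S, xcoord j x +
    ℓ * (d + 1 - g - ∑ j : LoopIndex g n, xcoord j x) / (2 * g - 2 + delta g)

/-- The subspace `W_D(ℓ, S, k)` of `D_{g,n}`. -/
def wallD {g n : ℕ} (d : ℝ) (ℓ : ℕ) (S : Finset (LoopIndex g n)) (k : ℤ) : Set (DSpace g n) :=
  {x | wallFunD d ℓ S x = k}

/-- The collection of all `W_C(i, S, k)`. -/
def wallsC (g n : ℕ) (d : ℝ) : Set (Set (CSpace g n)) :=
  {X | ∃ (p : SepIndex g n) (k : ℤ), X = wallC d p k}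

/-- The collection of all `W_D(ℓ, S, k)`, where `0 ≤ ℓ < 2g - 2 + δ_{1,g}` and
`(ℓ, S) ≠ (0, ∅)`. It is empty for `g = 0`. -/
def wallsD (g n : ℕ) (d : ℝ) : Set (Set (DSpace g n)) :=
  {X | ∃ (ℓ : ℕ) (S : Finset (LoopIndex g n)) (k : ℤ),
    (ℓ : ℤ) < 2 * g - 2 + delta g ∧ ¬(ℓ = 0 ∧ S = ∅) ∧ X = wallD d ℓ S k}

/-- The open unit hypercubes in `C_{g,n}` with faces on consecutive hyperplanes `W_C(i, S, k)`. -/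
def unitCubesC (g n : ℕ) (d : ℝ) : Set (Set (CSpace g n)) :=
  {Q | ∃ m : SepIndex g n → ℤ, Q = {ψ | ∀ p,
    wallLevelC g d p.1.1.val (m p) < alpha p ψ ∧
      alpha p ψ < wallLevelC g d p.1.1.val (m p) + 1}}

/-- The interior of a bounded convex polytope: a bounded set which is the intersection of
finitely many open affine half-spaces. -/
def IsOpenPolytope {g n : ℕ} (Q : Set (DSpace g n)) : Prop :=
  Bornology.IsBounded Q ∧
    ∃ F : Finset (DSpace g n →ᵃ[ℝ] ℝ), Q = {x | ∀ f ∈ F, 0 < f x}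

end UnivStab

end

open UnivStab

/-! A parameter is controlled by its sums over elementary subgraphs `U`. Contracting every edge that
does not cross the cut between `U` and its complement leaves a vine graph, with two vertices and `α`
edges, and compatibility with contractions identifies the sum over `U` with the value at one vertex
of the vine (`exists_vine`). That vine is read off from three quantities that contractions preserve:
the size of the cut, the dualizing degree `2i - 2 + α` of `U`, and the markings on `U`. Conversely,
these sums determine the parameter: deleting a vertex from a connected graph leaves components which
are all elementary (`sum_ne_eq_zero_of_elementary`). So only the values on vines matter.

Vines with one edge give the coordinates `α_{i,S}`. On vines with `α ≥ 2`, graphs with three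
mutually adjacent vertices impose additivity relations (`vineValue_add`). They force the value to be
`∑_{s ∈ S} φ_s + ℓ t` with `ℓ = 2i - 2 + α`, where `φ_s` is the value for two edges, genus `0` and
the single marking `s`, and `t` the value for three edges, genus `0` and no marking
(`vineValue_nonsep`). Adding the two sides of a vine gives `(2g - 2) t = d - ∑ φ_s` for `g ≥ 2`; for
`g = 1` one has `ℓ = 0`, and `δ` only keeps the denominator nonzero. This gives injectivity. For
surjectivity, `linearParam` combines degrees placed on the markings, a multiple of the dualizing
degree, and antisymmetric contributions of the separating edges; the latter vanish on vines with
several edges, so the two sets of coordinates are independent.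

A stability subspace is now an equation "vine value `= k + α/2`". For `α = 1` it is a wall in `C`.
For `α ≥ 2`, moving `ℓ/2` to the left replaces `d` by `d + 1 - g` and leaves the integer `k + 1 - i`
on the right, which is a wall in `D`; conversely two or three edges realize every admissible `ℓ`,
according to its parity. Both families consist of the integer levels of affine functions, so their
chambers are the nonempty convex cells with prescribed integer parts
(`connectedComponentIn_integer_levels`), and the chambers upstairs are products because the
complement is a product (`chambers_prod`). -/

noncomputable section
namespace UnivStab
namespace MarkedGraph

open scoped Classical

variable {n : ℕ}

/-! ### The multidegree of the dualizing sheaf -/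

/-- The degree of the dualizing sheaf on the component `v`. -/
def omega (Γ : MarkedGraph n) (v : Γ.Vert) : ℤ := 2 * Γ.genus v - 2 + Γ.valence v

/-- The degree of the dualizing sheaf on the subcurve `U`. -/
def omegaSum (Γ : MarkedGraph n) (U : Finset Γ.Vert) : ℤ := ∑ v ∈ U, Γ.omega v

/-- The markings lying on `U`. -/
def marks (Γ : MarkedGraph n) (U : Finset Γ.Vert) : Finset (Fin n) :=
  Finset.univ.filter fun j => Γ.marking j ∈ U

theorem mem_marks {Γ : MarkedGraph n} {U : Finset Γ.Vert} {j : Fin n} :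
    j ∈ Γ.marks U ↔ Γ.marking j ∈ U := by simp [marks]

theorem marks_compl (Γ : MarkedGraph n) (U : Finset Γ.Vert) : Γ.marks Uᶜ = (Γ.marks U)ᶜ := by
  ext j
  simp [mem_marks]

theorem valence_eq_sum (Γ : MarkedGraph n) (v : Γ.Vert) :
    Γ.valence v = ∑ h, if Γ.endpoint h = v then 1 else 0 := by
  rw [valence, Nat.card_eq_fintype_card, Fintype.card_subtype, Finset.card_filter]

theorem numMarkings_eq_sum (Γ : MarkedGraph n) (v : Γ.Vert) :
    Γ.numMarkings v = ∑ j, if Γ.marking j = v then 1 else 0 := by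
  rw [numMarkings, Nat.card_eq_fintype_card, Fintype.card_subtype, Finset.card_filter]

theorem cutSize_eq_sum (Γ : MarkedGraph n) (U : Finset Γ.Vert) :
    Γ.cutSize U = ∑ h, if Γ.endpoint h ∈ U ∧ Γ.endpoint (Γ.inv h) ∉ U then 1 else 0 := by
  rw [cutSize, Nat.card_eq_fintype_card, Fintype.card_subtype, Finset.card_filter]

/-- The involution as an equivalence. -/
def invEquiv (Γ : MarkedGraph n) : Γ.HalfEdge ≃ Γ.HalfEdge :=
  ⟨Γ.inv, Γ.inv, Γ.inv_inv, Γ.inv_inv⟩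

theorem cutSize_compl (Γ : MarkedGraph n) (U : Finset Γ.Vert) :
    Γ.cutSize Uᶜ = Γ.cutSize U := by
  rw [cutSize_eq_sum, cutSize_eq_sum, ← Equiv.sum_comp Γ.invEquiv]
  refine Finset.sum_congr rfl fun h _ => ?_
  simp only [invEquiv, Equiv.coe_fn_mk, inv_inv, Finset.mem_compl, not_not]
  exact if_congr and_comm rfl rfl

/-- The valences add up to the number of half-edges, twice the number of edges. Through this
identity the arithmetic genus is handled by means of dualizing degrees. -/
theorem sum_omega (Γ : MarkedGraph n) : ∑ v, Γ.omega v = 2 * Γ.arithGenus - 2 := by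
  have h1 := Γ.two_mul_card_edge
  have h2 := Γ.sum_valence
  simp only [omega, Finset.sum_add_distrib, Finset.sum_sub_distrib, ← Finset.mul_sum]
  rw [arithGenus]
  have h1' : (2 : ℤ) * Nat.card Γ.Edge = Fintype.card Γ.HalfEdge := by exact_mod_cast h1
  have h2' : ∑ v, (Γ.valence v : ℤ) = Fintype.card Γ.HalfEdge := by exact_mod_cast h2
  rw [h2', Finset.sum_const, Finset.card_univ, nsmul_eq_mul]
  linarith

theorem omegaSum_add_compl (Γ : MarkedGraph n) (U : Finset Γ.Vert) :
    Γ.omegaSum U + Γ.omegaSum Uᶜ = 2 * Γ.arithGenus - 2 := by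
  rw [← sum_omega]
  exact Finset.sum_add_sum_compl U _

/-! ### Contractions of one edge -/

/-- The vertex map of the strict contraction of the edge `{h, inv h}`. -/
def contractVert (Γ : MarkedGraph n) (h : Γ.HalfEdge) (v : Γ.Vert) : (Γ.contract h).Vert :=
  Quotient.mk (Γ.contractSetoid h) v

theorem contractVert_surjective (Γ : MarkedGraph n) (h : Γ.HalfEdge) :
    Function.Surjective (Γ.contractVert h) := Quotient.mk_surjective

theorem contractVert_eq_iff (Γ : MarkedGraph n) (h : Γ.HalfEdge) (v w : Γ.Vert) :
    Γ.contractVert h v = Γ.contractVert h w ↔ v = w ∨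
    ((v = Γ.endpoint h ∨ v = Γ.endpoint (Γ.inv h)) ∧
      (w = Γ.endpoint h ∨ w = Γ.endpoint (Γ.inv h))) :=
  ⟨fun hh => (Quotient.exact hh : (Γ.contractSetoid h).r v w),
    fun hh => Quotient.sound (show (Γ.contractSetoid h).r v w from hh)⟩

theorem contractVert_endpoint_inv (Γ : MarkedGraph n) (h : Γ.HalfEdge) :
    Γ.contractVert h (Γ.endpoint (Γ.inv h)) = Γ.contractVert h (Γ.endpoint h) :=
  (Γ.contractVert_eq_iff h _ _).2 (Or.inr ⟨Or.inr rfl, Or.inl rfl⟩)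

theorem sum_halfEdge_contract {M : Type*} [AddCommMonoid M] (Γ : MarkedGraph n) (h : Γ.HalfEdge)
    (f : Γ.HalfEdge → M) :
    ∑ x, f x = ∑ x : (Γ.contract h).HalfEdge, f x.1 + (f h + f (Γ.inv h)) := by
  have h1 : ∑ x : (Γ.contract h).HalfEdge, f x.1 =
      ∑ x ∈ Finset.univ.filter (fun x => x ≠ h ∧ x ≠ Γ.inv h), f x :=
    (Finset.sum_subtype (p := fun x => x ≠ h ∧ x ≠ Γ.inv h) _ (by simp) f).symm
  have h2 : f h + f (Γ.inv h) =
      ∑ x ∈ Finset.univ.filter (fun x => ¬ (x ≠ h ∧ x ≠ Γ.inv h)), f x := by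
    rw [← Finset.sum_pair (Γ.inv_ne h).symm]
    refine Finset.sum_congr ?_ fun _ _ => rfl
    ext x
    simp only [Finset.mem_insert, Finset.mem_singleton, Finset.mem_filter, Finset.mem_univ,
      true_and]
    tauto
  rw [h1, h2, Finset.sum_filter_add_sum_filter_not]

theorem card_halfEdge_contract (Γ : MarkedGraph n) (h : Γ.HalfEdge) :
    Fintype.card Γ.HalfEdge = Fintype.card (Γ.contract h).HalfEdge + 2 := by
  rw [Fintype.card_eq_sum_ones, Fintype.card_eq_sum_ones, Γ.sum_halfEdge_contract h]

theorem valence_contract (Γ : MarkedGraph n) (h : Γ.HalfEdge) (w : (Γ.contract h).Vert) :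
    ∑ v with Γ.contractVert h v = w, Γ.valence v =
      (Γ.contract h).valence w + if Γ.contractVert h (Γ.endpoint h) = w then 2 else 0 := by
  have h1 : ∑ v with Γ.contractVert h v = w, Γ.valence v =
      ∑ x, if Γ.contractVert h (Γ.endpoint x) = w then 1 else 0 := by
    simp only [valence_eq_sum]
    rw [Finset.sum_comm]
    refine Finset.sum_congr rfl fun x _ => ?_
    simp [Finset.sum_ite_eq]
  rw [h1, Γ.sum_halfEdge_contract h, valence_eq_sum, contractVert_endpoint_inv]
  congr 1
  split_ifs <;> rfl

theorem numMarkings_contract (Γ : MarkedGraph n) (h : Γ.HalfEdge) (w : (Γ.contract h).Vert) :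
    ∑ v with Γ.contractVert h v = w, Γ.numMarkings v = (Γ.contract h).numMarkings w := by
  simp only [numMarkings_eq_sum]
  rw [Finset.sum_comm]
  refine Finset.sum_congr rfl fun x _ => ?_
  simp only [Finset.sum_ite_eq, Finset.mem_filter, Finset.mem_univ, true_and]
  rfl

theorem contract_genus (Γ : MarkedGraph n) (h : Γ.HalfEdge) (w : (Γ.contract h).Vert) :
    (Γ.contract h).genus w = (∑ v with Γ.contractVert h v = w, Γ.genus v) +
    if Γ.contractVert h (Γ.endpoint h) = w ∧
      Γ.endpoint h = Γ.endpoint (Γ.inv h) then 1 else 0 := by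
  unfold contract contractVert
  congr!

theorem card_fiber_contract (Γ : MarkedGraph n) (h : Γ.HalfEdge) (w : (Γ.contract h).Vert) :
    (Finset.univ.filter fun v => Γ.contractVert h v = w).card =
      1 + if Γ.contractVert h (Γ.endpoint h) = w ∧
      Γ.endpoint h ≠ Γ.endpoint (Γ.inv h) then 1 else 0 := by
  obtain ⟨u, rfl⟩ := Γ.contractVert_surjective h w
  by_cases hu : u = Γ.endpoint h ∨ u = Γ.endpoint (Γ.inv h)
  · have h1 : (Finset.univ.filter fun v => Γ.contractVert h v = Γ.contractVert h u) =
        {Γ.endpoint h, Γ.endpoint (Γ.inv h)} := by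
      ext v
      simp only [Finset.mem_filter, Finset.mem_univ, true_and, contractVert_eq_iff,
        Finset.mem_insert, Finset.mem_singleton]
      constructor
      · rintro (rfl | h)
        exacts [hu, h.1]
      · exact fun h => Or.inr ⟨h, hu⟩
    have h2 : Γ.contractVert h (Γ.endpoint h) = Γ.contractVert h u :=
      (contractVert_eq_iff _ _ _ _).2 (Or.inr ⟨Or.inl rfl, hu⟩)
    rw [h1]
    by_cases hl : Γ.endpoint h = Γ.endpoint (Γ.inv h)
    · simp [← hl]
    · rw [Finset.card_pair hl, if_pos ⟨h2, hl⟩]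
  · have h1 : (Finset.univ.filter fun v => Γ.contractVert h v = Γ.contractVert h u) = {u} := by
      ext v
      simp only [Finset.mem_filter, Finset.mem_univ, true_and, contractVert_eq_iff,
        Finset.mem_singleton]
      tauto
    rw [h1, if_neg, Finset.card_singleton]
    rw [contractVert_eq_iff]
    rintro ⟨h | h, -⟩
    · exact hu (Or.inl h.symm)
    · exact hu h.2

/-- The two half-edges lost at the merged vertex are compensated by the `-2` of the vertex that
disappears, or, for a loop, by the extra unit of genus. -/
theorem omega_contract (Γ : MarkedGraph n) (h : Γ.HalfEdge) (w : (Γ.contract h).Vert) :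
    (Γ.contract h).omega w = ∑ v with Γ.contractVert h v = w, Γ.omega v := by
  have h1 := congrArg (Nat.cast : ℕ → ℤ) (Γ.valence_contract h w)
  have h2 := congrArg (Nat.cast : ℕ → ℤ) (Γ.contract_genus h w)
  have h3 := congrArg (Nat.cast : ℕ → ℤ) (Γ.card_fiber_contract h w)
  simp only [omega, Finset.sum_add_distrib, Finset.sum_sub_distrib, ← Finset.mul_sum,
    Finset.sum_const, nsmul_eq_mul]
  push_cast at h1 h2 h3
  rw [h1, h2, h3]
  split_ifs <;> first | tauto | ring

/-- The preimage of a set of vertices under a contraction. -/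
def pullback (Γ : MarkedGraph n) (h : Γ.HalfEdge) (U : Finset (Γ.contract h).Vert) :
    Finset Γ.Vert := Finset.univ.filter fun v => Γ.contractVert h v ∈ U

theorem mem_pullback {Γ : MarkedGraph n} {h : Γ.HalfEdge} {U : Finset (Γ.contract h).Vert}
    {v : Γ.Vert} : v ∈ Γ.pullback h U ↔ Γ.contractVert h v ∈ U := by simp [pullback]

theorem sum_pullback {M : Type*} [AddCommMonoid M] (Γ : MarkedGraph n) (h : Γ.HalfEdge)
    (U : Finset (Γ.contract h).Vert) (f : Γ.Vert → M) :
    ∑ v ∈ Γ.pullback h U, f v = ∑ w ∈ U, ∑ v with Γ.contractVert h v = w, f v := by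
  rw [← Finset.sum_fiberwise_of_maps_to (s := Γ.pullback h U) (t := U) (g := Γ.contractVert h)
    (fun v hv => mem_pullback.1 hv)]
  refine Finset.sum_congr rfl fun w hw => Finset.sum_congr ?_ fun _ _ => rfl
  ext v
  simp only [Finset.mem_filter, mem_pullback, Finset.mem_univ, true_and, and_iff_right_iff_imp]
  rintro rfl
  exact hw

theorem omegaSum_pullback (Γ : MarkedGraph n) (h : Γ.HalfEdge)
    (U : Finset (Γ.contract h).Vert) :
    Γ.omegaSum (Γ.pullback h U) = (Γ.contract h).omegaSum U := by
  simp only [omegaSum, sum_pullback, omega_contract]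

theorem marks_pullback (Γ : MarkedGraph n) (h : Γ.HalfEdge)
    (U : Finset (Γ.contract h).Vert) :
    Γ.marks (Γ.pullback h U) = (Γ.contract h).marks U := by
  ext j
  rw [mem_marks, mem_marks, mem_pullback]
  rfl

theorem cutSize_pullback (Γ : MarkedGraph n) (h : Γ.HalfEdge)
    (U : Finset (Γ.contract h).Vert) :
    Γ.cutSize (Γ.pullback h U) = (Γ.contract h).cutSize U := by
  simp only [cutSize_eq_sum]
  rw [Γ.sum_halfEdge_contract h]
  simp only [mem_pullback, inv_inv, contractVert_endpoint_inv, and_not_self, if_false, add_zero]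
  rfl

/-- The total dualizing degree is `2g - 2` and is preserved by contraction, so edges need not be
counted again. -/
theorem arithGenus_contract (Γ : MarkedGraph n) (h : Γ.HalfEdge) :
    (Γ.contract h).arithGenus = Γ.arithGenus := by
  have h1 := Γ.sum_omega
  have h2 := (Γ.contract h).sum_omega
  have h3 := Γ.omegaSum_pullback h Finset.univ
  have h4 : Γ.pullback h Finset.univ = Finset.univ := by
    ext v
    simp [mem_pullback]
  rw [h4] at h3
  rw [omegaSum, omegaSum] at h3
  omega

/-! ### Connectedness and stability under contraction -/

/-- A walk is mapped step by step: each edge either collapses to a point or remains an edge. -/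
theorem preconnected_induce_image {V W : Type*} {G : SimpleGraph V} {H : SimpleGraph W}
    (q : V → W) (hq : ∀ v w, G.Adj v w → q v = q w ∨ H.Adj (q v) (q w)) {s : Set V} {t : Set W}
    (hst : q '' s = t) (hs : (G.induce s).Connected) : (H.induce t).Connected := by
  subst hst
  have key : ∀ a b : s, (G.induce s).Reachable a b →
      (H.induce (q '' s)).Reachable ⟨q a, a, a.2, rfl⟩ ⟨q b, b, b.2, rfl⟩ := by
    rintro a b ⟨p⟩
    induction p with
    | nil => exact SimpleGraph.Reachable.refl _
    | cons hadj _ ih =>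
      refine SimpleGraph.Reachable.trans ?_ ih
      rcases hq _ _ (SimpleGraph.comap_adj.1 hadj) with h | h
      · have : ∀ (x y : q '' s), x.1 = y.1 → (H.induce (q '' s)).Reachable x y := by
          rintro ⟨x, hx⟩ ⟨y, hy⟩ h
          obtain rfl : x = y := h
          exact SimpleGraph.Reachable.refl _
        exact this _ _ h
      · exact SimpleGraph.Adj.reachable (SimpleGraph.comap_adj.2 h)
  have hne : Nonempty (q '' s) := by
    obtain ⟨a⟩ := hs.nonempty
    exact ⟨⟨q a, a, a.2, rfl⟩⟩
  refine SimpleGraph.Connected.mk ?_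
  rintro ⟨_, a, ha, rfl⟩ ⟨_, b, hb, rfl⟩
  exact key ⟨a, ha⟩ ⟨b, hb⟩ (hs.preconnected _ _)

theorem contractVert_adj (Γ : MarkedGraph n) (h : Γ.HalfEdge) (v w : Γ.Vert)
    (hvw : Γ.adjGraph.Adj v w) : Γ.contractVert h v = Γ.contractVert h w ∨
      (Γ.contract h).adjGraph.Adj (Γ.contractVert h v) (Γ.contractVert h w) := by
  obtain ⟨hne, x, rfl, rfl⟩ := hvw
  by_cases hx : x ≠ h ∧ x ≠ Γ.inv h
  · refine or_iff_not_imp_left.2 fun hn => ⟨hn, ⟨x, hx⟩, rfl, rfl⟩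
  · left
    rw [not_and_or, not_not, not_not] at hx
    rcases hx with rfl | rfl
    · exact (contractVert_endpoint_inv _ _).symm
    · rw [inv_inv]
      exact contractVert_endpoint_inv _ _

theorem connected_of_induce {V : Type*} {G : SimpleGraph V}
    (h : (G.induce Set.univ).Connected) : G.Connected :=
  (SimpleGraph.induceUnivIso G).connected_iff.1 h

/-- In genus zero, stability says that dualizing degree plus number of markings is at least `1`.
This quantity is additive over the fibres of a contraction, and a vertex of genus zero has only
preimages of genus zero. -/
theorem isStable_contract {Γ : MarkedGraph n} (hΓ : Γ.IsStable) (h : Γ.HalfEdge) :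
    (Γ.contract h).IsStable := by
  refine ⟨?_, fun w hw => ?_⟩
  · refine connected_of_induce (preconnected_induce_image (Γ.contractVert h)
      (Γ.contractVert_adj h) ?_ ((SimpleGraph.induceUnivIso Γ.adjGraph).connected_iff.2 hΓ.1))
    rw [Set.image_univ, (Γ.contractVert_surjective h).range_eq]
  · obtain ⟨u, rfl⟩ := Γ.contractVert_surjective h w
    have h1 := Γ.omega_contract h (Γ.contractVert h u)
    have h2 := Γ.numMarkings_contract h (Γ.contractVert h u)
    have h3 := Γ.contract_genus h (Γ.contractVert h u)
    rw [hw] at h3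
    have h4 := Nat.eq_zero_of_add_eq_zero_right h3.symm
    rw [Finset.sum_eq_zero_iff] at h4
    have h5 : ∀ v, Γ.contractVert h v = Γ.contractVert h u →
        1 ≤ Γ.omega v + Γ.numMarkings v := by
      intro v hv
      have h6 := h4 v (by simp [hv])
      have h7 := hΓ.2 v h6
      rw [omega, h6]
      push_cast
      omega
    have h6 : (1 : ℤ) ≤ ∑ v with Γ.contractVert h v = Γ.contractVert h u,
        (Γ.omega v + Γ.numMarkings v) :=
      (h5 u rfl).trans (Finset.single_le_sum (f := fun v => Γ.omega v + (Γ.numMarkings v : ℤ))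
        (fun v hv => zero_le_one.trans (h5 v (by simpa using hv))) (by simp))
    rw [Finset.sum_add_distrib, ← h1, ← Nat.cast_sum, h2, omega, hw] at h6
    push_cast at h6
    omega

theorem isElementary_of_pullback {Γ : MarkedGraph n} {h : Γ.HalfEdge}
    {U : Finset (Γ.contract h).Vert} (hU : Γ.IsElementary (Γ.pullback h U)) :
    (Γ.contract h).IsElementary U := by
  have key : ∀ s : Set (Γ.contract h).Vert, Γ.contractVert h '' (Γ.contractVert h ⁻¹' s) = s :=
    fun s => Set.image_preimage_eq s (Γ.contractVert_surjective h)
  have h1 : ((Γ.pullback h U : Finset Γ.Vert) : Set Γ.Vert) = Γ.contractVert h ⁻¹' U := by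
    ext v
    simp [mem_pullback]
  refine ⟨preconnected_induce_image _ (Γ.contractVert_adj h) ?_ hU.1,
    preconnected_induce_image _ (Γ.contractVert_adj h) ?_ hU.2⟩
  · rw [h1, key]
  · rw [h1, ← Set.preimage_compl, key]

/-- The identity isomorphism. -/
def Iso.refl (Γ : MarkedGraph n) : Iso Γ Γ :=
  ⟨Equiv.refl _, Equiv.refl _, fun _ => rfl, fun _ => rfl, fun _ => rfl, fun _ => rfl⟩

end MarkedGraph
end UnivStab
end

noncomputable section
namespace UnivStab
open scoped Classical
namespace MarkedGraph
variable {n : ℕ}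

/-! ### Reduction of elementary subgraphs to vine graphs -/

theorem isElementary_of_adj {Γ : MarkedGraph n} (hadj : ∀ v w, v ≠ w → Γ.adjGraph.Adj v w)
    {U : Finset Γ.Vert} (hU : U.Nonempty) (hU' : ∃ v, v ∉ U) : Γ.IsElementary U := by
  have key : ∀ s : Set Γ.Vert, s.Nonempty → (Γ.adjGraph.induce s).Connected := by
    intro s hs
    have : Nonempty s := hs.to_subtype
    refine SimpleGraph.Connected.mk fun a b => ?_
    by_cases hab : a = b
    · rw [hab]
    · exact SimpleGraph.Adj.reachable
        (SimpleGraph.comap_adj.2 (hadj _ _ fun h => hab (Subtype.ext h)))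
  refine ⟨key _ (by simpa using hU), key _ ?_⟩
  obtain ⟨v, hv⟩ := hU'
  exact ⟨v, hv⟩

theorem exists_eq_singleton_of_connected {V : Type*} {G : SimpleGraph V} {s : Set V}
    (hs : (G.induce s).Connected) (hadj : ∀ v ∈ s, ∀ w ∈ s, ¬ G.Adj v w) : ∃ a, s = {a} := by
  have h1 : G.induce s = ⊥ := by
    ext v w
    simpa using hadj v v.2 w w.2
  rw [h1] at hs
  have h2 := SimpleGraph.preconnected_bot_iff_subsingleton.1 hs.preconnected
  obtain ⟨a⟩ := hs.nonempty
  refine ⟨a, Set.eq_singleton_iff_unique_mem.2 ⟨a.2, fun b hb => ?_⟩⟩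
  exact congrArg Subtype.val (Subsingleton.elim (⟨b, hb⟩ : s) a)

theorem one_le_of_vine_isStable {α i j : ℕ} {S : Finset (Fin n)}
    (h : (vine α i j S).IsStable) : 1 ≤ α := by
  by_contra hα
  obtain rfl : α = 0 := by omega
  have h1 : (vine 0 i j S).adjGraph = ⊥ := by
    ext v w
    simp only [SimpleGraph.bot_adj, iff_false]
    rintro ⟨-, x, -⟩
    exact x.2.elim0
  have h2 := h.1
  rw [h1] at h2
  have h3 := SimpleGraph.preconnected_bot_iff_subsingleton.1 h2.preconnected
  exact Bool.noConfusion (@Subsingleton.elim Bool h3 true false)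

/-- An isomorphism of a vine graph with a graph without edges inside `{a}` and inside `{b}`. -/
theorem exists_iso_vine (Γ : MarkedGraph n) (a b : Γ.Vert) (hab : ({a} : Finset Γ.Vert)ᶜ = {b})
    (hcut : ∀ h, ¬ (Γ.endpoint h = a ↔ Γ.endpoint (Γ.inv h) = a)) :
    ∃ f : Iso (vine (Γ.cutSize {a}) (Γ.genus a) (Γ.genus b) (Γ.marks {a})) Γ,
      f.vert true = a ∧ f.vert false = b := by
  have hb : ∀ v, v ≠ a ↔ v = b := fun v => by
    have := Finset.ext_iff.1 hab v
    simpa using this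
  have hne : b ≠ a := (hb b).2 rfl
  let e : {h : Γ.HalfEdge // Γ.endpoint h ∈ ({a} : Finset Γ.Vert) ∧
    Γ.endpoint (Γ.inv h) ∉ ({a} : Finset Γ.Vert)} ≃ Fin (Γ.cutSize {a}) := Finite.equivFin _
  let fv : Bool → Γ.Vert := fun x => if x then a else b
  have hfv : Function.Bijective fv := by
    constructor
    · rintro (_ | _) (_ | _) h
      · rfl
      · exact absurd h hne
      · exact absurd h.symm hne
      · rfl
    · intro v
      by_cases hv : v = a
      · exact ⟨true, hv.symm⟩
      · exact ⟨false, ((hb v).1 hv).symm⟩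
  let fh : Bool × Fin (Γ.cutSize {a}) → Γ.HalfEdge := fun x =>
    if x.1 then (e.symm x.2).1 else Γ.inv (e.symm x.2).1
  have he : ∀ k, Γ.endpoint (e.symm k).1 = a ∧ Γ.endpoint (Γ.inv (e.symm k).1) = b := fun k => by
    have := (e.symm k).2
    rw [Finset.mem_singleton, Finset.mem_singleton] at this
    exact ⟨this.1, (hb _).1 this.2⟩
  have hend : ∀ x, fv x.1 = Γ.endpoint (fh x) := by
    rintro ⟨_ | _, k⟩
    · exact (he k).2.symm
    · exact (he k).1.symm
  have hfh : Function.Bijective fh := by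
    constructor
    · intro x y hxy
      have h1 : x.1 = y.1 := hfv.1 (by rw [hend, hend, hxy])
      obtain ⟨x1, x2⟩ := x
      obtain ⟨y1, y2⟩ := y
      obtain rfl : x1 = y1 := h1
      have h2 : (e.symm x2).1 = (e.symm y2).1 := by
        cases x1
        · exact Γ.invEquiv.injective hxy
        · exact hxy
      rw [e.symm.injective (Subtype.ext h2)]
    · intro h
      have hh := hcut h
      by_cases h1 : Γ.endpoint h = a
      · have h2 : Γ.endpoint (Γ.inv h) ≠ a := fun h2 => hh ⟨fun _ => h2, fun _ => h1⟩
        refine ⟨(true, e ⟨h, by simpa using h1, by simpa using h2⟩), ?_⟩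
        simp [fh]
      · have h2 : Γ.endpoint (Γ.inv h) = a := by
          by_contra h2
          exact hh ⟨fun h => absurd h h1, fun h => absurd h h2⟩
        refine ⟨(false, e ⟨Γ.inv h, by simpa using h2, by simpa [Γ.inv_inv] using h1⟩), ?_⟩
        simp [fh, Γ.inv_inv]
  refine ⟨⟨Equiv.ofBijective fv hfv, Equiv.ofBijective fh hfh, ?_, hend, ?_, ?_⟩, rfl, rfl⟩
  · rintro ⟨_ | _, k⟩
    · exact (Γ.inv_inv _).symm
    · rfl
  · rintro (_ | _) <;> rfl
  · intro j
    change (if decide (j ∈ Γ.marks {a}) then a else b) = _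
    by_cases hj : Γ.marking j = a
    · rw [if_pos (by simpa [mem_marks] using hj), hj]
    · rw [if_neg (by simpa [mem_marks] using hj), (hb _).1 hj]

end MarkedGraph

/-! ### Sums over elementary subgraphs as values on vine graphs -/

open MarkedGraph

variable {g n : ℕ}

/-- The value of a family at the first vertex of the vine graph with `α` edges whose first vertex
has genus `i` and carries the markings in `S` (zero when this graph is not stable). -/
def vineValue (φ : Family g n) (α i : ℕ) (S : Finset (Fin n)) : ℝ :=
  if h : (vine α i (g + 1 - α - i) S).IsStable ∧ (vine α i (g + 1 - α - i) S).arithGenus = g then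
    φ ⟨vine α i (g + 1 - α - i) S, h⟩ (true : Bool) else 0

theorem vineValue_eq {φ : Family g n} {α i j : ℕ} {S : Finset (Fin n)}
    (h : (vine α i j S).IsStable ∧ (vine α i j S).arithGenus = g) :
    vineValue φ α i S = φ ⟨vine α i j S, h⟩ (true : Bool) := by
  have h1 := h.2
  rw [vine_arithGenus] at h1
  obtain rfl : j = g + 1 - α - i := by omega
  rw [vineValue, dif_pos h]

/-- Induction on the number of half-edges: contracting an edge that does not cross the cut changes
neither the cut, the dualizing degree and the markings of `U`, nor the sum of a parameter over `U`.
-/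
theorem exists_vine_of_card (N : ℕ) : ∀ (Γ : StableGraph g n) (_ : Fintype.card Γ.1.HalfEdge = N)
    (U : Finset Γ.1.Vert), Γ.1.IsElementary U →
    ∃ (α i j : ℕ) (S : Finset (Fin n))
      (h : (vine α i j S).IsStable ∧ (vine α i j S).arithGenus = g),
      Γ.1.cutSize U = α ∧ Γ.1.omegaSum U = 2 * i - 2 + α ∧ Γ.1.marks U = S ∧
      ∀ φ ∈ stabSpace g n, ∑ v ∈ U, φ Γ v = φ ⟨vine α i j S, h⟩ (true : Bool) := by
  induction N using Nat.strong_induction_on with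
  | _ N ih =>
  intro Γ hN U hU
  -- The equivalence covers the edges inside `U`, those inside its complement, and all loops.
  by_cases hint : ∃ h, (Γ.1.endpoint h ∈ U ↔ Γ.1.endpoint (Γ.1.inv h) ∈ U)
  · obtain ⟨h, hh⟩ := hint
    let Γ' : StableGraph g n :=
      ⟨Γ.1.contract h, isStable_contract Γ.2.1 h, (arithGenus_contract _ h).trans Γ.2.2⟩
    let U' : Finset (Γ.1.contract h).Vert := U.image (Γ.1.contractVert h)
    have hUU' : Γ.1.pullback h U' = U := by
      ext v
      rw [mem_pullback, Finset.mem_image]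
      constructor
      · rintro ⟨u, hu, huv⟩
        rcases (contractVert_eq_iff _ _ _ _).1 huv with rfl | ⟨rfl | rfl, rfl | rfl⟩ <;> tauto
      · exact fun hv => ⟨v, hv, rfl⟩
    have hcard := Γ.1.card_halfEdge_contract h
    obtain ⟨α, i, j, S, hv, h1, h2, h3, h4⟩ :=
      ih (Fintype.card (Γ.1.contract h).HalfEdge) (by omega) Γ' rfl U'
        (isElementary_of_pullback (by rwa [hUU']))
    refine ⟨α, i, j, S, hv, ?_, ?_, ?_, fun φ hφ => ?_⟩
    · rw [← h1, ← hUU', cutSize_pullback]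
    · rw [← h2, ← hUU', omegaSum_pullback]
    · rw [← h3, ← hUU', marks_pullback]
    · conv_lhs => rw [← hUU', sum_pullback]
      rw [← h4 φ hφ]
      refine Finset.sum_congr rfl fun w _ => ?_
      exact (hφ.2 Γ Γ' ⟨h, Iso.refl _⟩ w).symm
  · have hcut : ∀ h, ¬ (Γ.1.endpoint h ∈ U ↔ Γ.1.endpoint (Γ.1.inv h) ∈ U) :=
      fun h hh => hint ⟨h, hh⟩
    -- Every edge now crosses the cut, so each of the two connected sides is a single vertex.
    obtain ⟨a, ha⟩ := exists_eq_singleton_of_connected hU.1 (by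
      rintro v hv w hw ⟨-, h, rfl, rfl⟩
      exact hcut h ⟨fun _ => hw, fun _ => hv⟩)
    obtain ⟨b, hb⟩ := exists_eq_singleton_of_connected hU.2 (by
      rintro v hv w hw ⟨-, h, rfl, rfl⟩
      exact hcut h ⟨fun h => absurd h hv, fun h => absurd h hw⟩)
    obtain rfl : U = {a} := by exact_mod_cast ha
    have hb' : ({a} : Finset Γ.1.Vert)ᶜ = {b} := by exact_mod_cast hb
    obtain ⟨f, hfa, hfb⟩ := exists_iso_vine Γ.1 a b hb' (by simpa using hcut)
    have hva : Γ.1.valence a = Γ.1.cutSize {a} := by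
      rw [valence_eq_sum, cutSize_eq_sum]
      refine Finset.sum_congr rfl fun h _ => ?_
      have := hcut h
      simp only [Finset.mem_singleton] at this ⊢
      exact if_congr (by tauto) rfl rfl
    have hvb : Γ.1.valence b = Γ.1.cutSize {a} := by
      rw [← cutSize_compl, hb', valence_eq_sum, cutSize_eq_sum]
      refine Finset.sum_congr rfl fun h _ => ?_
      have := hcut h
      simp only [Finset.mem_singleton] at this ⊢
      have h1 : ∀ v, v = b ↔ v ≠ a := fun v => by
        have := Finset.ext_iff.1 hb' v
        simpa using this.symm
      refine if_congr ?_ rfl rfl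
      rw [h1, h1]
      tauto
    have hma : Γ.1.numMarkings a = (Γ.1.marks {a}).card := by
      rw [numMarkings_eq_sum, marks, Finset.card_filter]
      simp
    have hmb : Γ.1.numMarkings b = n - (Γ.1.marks {a}).card := by
      have h1 := Finset.card_compl (Γ.1.marks {a})
      rw [Fintype.card_fin, ← marks_compl, hb'] at h1
      rw [← h1, numMarkings_eq_sum, marks, Finset.card_filter]
      simp
    -- Without crossing edges there would be no edges at all, and `Γ` would be disconnected, having
    -- the two vertices `a` and `b`.
    have hα : 1 ≤ Γ.1.cutSize {a} := by
      by_contra hα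
      have h0 : Γ.1.cutSize {a} = 0 := by omega
      have hemp : ∀ h : Γ.1.HalfEdge, False := by
        intro h
        rw [cutSize_eq_sum, Finset.sum_eq_zero_iff] at h0
        have h1 := h0 h (Finset.mem_univ _)
        have h2 := h0 (Γ.1.inv h) (Finset.mem_univ _)
        have h3 := hcut h
        simp only [Γ.1.inv_inv, ite_eq_right_iff, one_ne_zero, imp_false] at h1 h2
        tauto
      have h1 : Γ.1.adjGraph = ⊥ := by
        ext v w
        simp only [SimpleGraph.bot_adj, iff_false]
        rintro ⟨-, x, -⟩
        exact hemp x
      have h2 := Γ.2.1.1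
      rw [h1] at h2
      have h3 := SimpleGraph.preconnected_bot_iff_subsingleton.1 h2.preconnected
      have h4 : b ∈ ({a} : Finset Γ.1.Vert)ᶜ := by simp [hb']
      exact (by simpa using h4 : b ≠ a) (Subsingleton.elim _ _)
    have hω := omegaSum_add_compl Γ.1 {a}
    rw [hb', omegaSum, omegaSum, Finset.sum_singleton, Finset.sum_singleton, omega, omega, hva,
      hvb, Γ.2.2] at hω
    have hsa := Γ.2.1.2 a
    have hsb := Γ.2.1.2 b
    rw [hva, hma] at hsa
    rw [hvb, hmb] at hsb
    refine ⟨Γ.1.cutSize {a}, Γ.1.genus a, Γ.1.genus b, Γ.1.marks {a},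
      ⟨vine_isStable _ _ _ _ hα hsa hsb, ?_⟩, rfl, ?_, rfl, fun φ hφ => ?_⟩
    · rw [vine_arithGenus]
      omega
    · rw [omegaSum, Finset.sum_singleton, omega, hva]
    · rw [Finset.sum_singleton]
      have := hφ.1 ⟨_, ⟨vine_isStable _ _ _ _ hα hsa hsb, by rw [vine_arithGenus]; omega⟩⟩ Γ f true
      rw [← this, hfa]

theorem exists_vine (Γ : StableGraph g n) {U : Finset Γ.1.Vert} (hU : Γ.1.IsElementary U) :
    ∃ (α i j : ℕ) (S : Finset (Fin n))
      (h : (vine α i j S).IsStable ∧ (vine α i j S).arithGenus = g),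
      Γ.1.cutSize U = α ∧ Γ.1.omegaSum U = 2 * i - 2 + α ∧ Γ.1.marks U = S ∧
      ∀ φ ∈ stabSpace g n, ∑ v ∈ U, φ Γ v = φ ⟨vine α i j S, h⟩ (true : Bool) :=
  exists_vine_of_card _ Γ rfl U hU

/-- Cut size, dualizing degree and markings determine the vine obtained from `U`, so sums over
subgraphs of different graphs can be compared through these three numerical data. -/
theorem sum_eq_vineValue {φ : Family g n} (hφ : φ ∈ stabSpace g n) (Γ : StableGraph g n)
    {U : Finset Γ.1.Vert} (hU : Γ.1.IsElementary U) {α i : ℕ} {S : Finset (Fin n)}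
    (hα : Γ.1.cutSize U = α)
    (hi : Γ.1.omegaSum U = 2 * i - 2 + α) (hS : Γ.1.marks U = S) :
    ∑ v ∈ U, φ Γ v = vineValue φ α i S := by
  obtain ⟨α', i', j', S', h, h1, h2, h3, h4⟩ := exists_vine Γ hU
  obtain rfl : α = α' := by omega
  obtain rfl : i = i' := by omega
  obtain rfl : S = S' := hS.symm.trans h3
  rw [h4 φ hφ, vineValue_eq h]

end UnivStab
end

noncomputable section
namespace UnivStab
open scoped Classical
namespace MarkedGraph
variable {n : ℕ}

/-! ### Graphs with three vertices -/

/-- The endpoints of the edges of a triangle with multiple edges. -/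
def triEnd (a b c : ℕ) : Bool × (Fin a ⊕ Fin b ⊕ Fin c) → Fin 3
  | (true, .inl _) => 1
  | (false, .inl _) => 2
  | (true, .inr (.inl _)) => 0
  | (false, .inr (.inl _)) => 2
  | (true, .inr (.inr _)) => 0
  | (false, .inr (.inr _)) => 1

/-- The graph with vertices `0`, `1`, `2` of genera `i`, `j`, `k`, with `a` edges between `1`
and `2`, `b` edges between `0` and `2` and `c` edges between `0` and `1`, the markings in `S` on
`0` and those in `T \ S` on `1`. -/
def tri (a b c i j k : ℕ) (S T : Finset (Fin n)) : MarkedGraph n where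
  Vert := Fin 3
  HalfEdge := Bool × (Fin a ⊕ Fin b ⊕ Fin c)
  vertFintype := inferInstance
  halfEdgeFintype := inferInstance
  endpoint := triEnd a b c
  inv h := (!h.1, h.2)
  inv_inv h := by simp
  inv_ne h hh := by simpa using congrArg Prod.fst hh
  genus := ![i, j, k]
  marking s := if s ∈ S then 0 else if s ∈ T then 1 else 2

theorem tri_valence (a b c i j k : ℕ) (S T : Finset (Fin n)) (v : Fin 3) :
    (tri a b c i j k S T).valence v = ![b + c, a + c, a + b] v := by
  change Nat.card {h : Bool × (Fin a ⊕ Fin b ⊕ Fin c) // triEnd a b c h = v} = _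
  rw [Nat.card_eq_fintype_card, Fintype.card_subtype, Finset.card_filter]
  fin_cases v <;> simp [Fintype.sum_prod_type, Fintype.sum_sum_type, triEnd]

theorem tri_cutSize_zero (a b c i j k : ℕ) (S T : Finset (Fin n)) :
    (tri a b c i j k S T).cutSize ({0} : Finset (Fin 3)) = b + c := by
  change Nat.card {h : Bool × (Fin a ⊕ Fin b ⊕ Fin c) //
    triEnd a b c h ∈ ({0} : Finset (Fin 3)) ∧ triEnd a b c (!h.1, h.2) ∉ ({0} : Finset (Fin 3))} = _
  rw [Nat.card_eq_fintype_card, Fintype.card_subtype, Finset.card_filter]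
  simp only [Fintype.sum_prod_type, Fintype.sum_sum_type, Fintype.sum_bool, triEnd]
  simp

theorem tri_cutSize_one (a b c i j k : ℕ) (S T : Finset (Fin n)) :
    (tri a b c i j k S T).cutSize ({1} : Finset (Fin 3)) = a + c := by
  change Nat.card {h : Bool × (Fin a ⊕ Fin b ⊕ Fin c) //
    triEnd a b c h ∈ ({1} : Finset (Fin 3)) ∧ triEnd a b c (!h.1, h.2) ∉ ({1} : Finset (Fin 3))} = _
  rw [Nat.card_eq_fintype_card, Fintype.card_subtype, Finset.card_filter]
  simp only [Fintype.sum_prod_type, Fintype.sum_sum_type, Fintype.sum_bool, triEnd]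
  simp

theorem tri_cutSize_pair (a b c i j k : ℕ) (S T : Finset (Fin n)) :
    (tri a b c i j k S T).cutSize ({0, 1} : Finset (Fin 3)) = a + b := by
  change Nat.card {h : Bool × (Fin a ⊕ Fin b ⊕ Fin c) //
    triEnd a b c h ∈ ({0, 1} : Finset (Fin 3)) ∧
      triEnd a b c (!h.1, h.2) ∉ ({0, 1} : Finset (Fin 3))} = _
  rw [Nat.card_eq_fintype_card, Fintype.card_subtype, Finset.card_filter]
  simp only [Fintype.sum_prod_type, Fintype.sum_sum_type, Fintype.sum_bool, triEnd]
  simp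

theorem tri_marks (a b c i j k : ℕ) (S T : Finset (Fin n)) (hST : Disjoint S T) :
    (tri a b c i j k S T).marks ({0} : Finset (Fin 3)) = S ∧
    (tri a b c i j k S T).marks ({1} : Finset (Fin 3)) = T ∧
    (tri a b c i j k S T).marks ({2} : Finset (Fin 3)) = (S ∪ T)ᶜ ∧
    (tri a b c i j k S T).marks ({0, 1} : Finset (Fin 3)) = S ∪ T := by
  have key : ∀ (U : Finset (Fin 3)) s, s ∈ (tri a b c i j k S T).marks U ↔
      (if s ∈ S then 0 else if s ∈ T then 1 else 2 : Fin 3) ∈ U := fun U s => mem_marks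
  have hd : ∀ s ∈ S, s ∉ T := fun s h => Finset.disjoint_left.1 hST h
  refine ⟨?_, ?_, ?_, ?_⟩ <;> ext s <;> rw [key] <;> have := hd s <;>
    by_cases h1 : s ∈ S <;> by_cases h2 : s ∈ T <;> simp_all

theorem tri_omega (a b c i j k : ℕ) (S T : Finset (Fin n)) (v : Fin 3) :
    (tri a b c i j k S T).omega v =
      2 * ((![i, j, k] v : ℕ) : ℤ) - 2 + ((![b + c, a + c, a + b] v : ℕ) : ℤ) := by
  change 2 * ((![i, j, k] v : ℕ) : ℤ) - 2 + (((tri a b c i j k S T).valence v : ℕ) : ℤ) = _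
  rw [tri_valence]

theorem numMarkings_eq_card_marks (Γ : MarkedGraph n) (v : Γ.Vert) :
    Γ.numMarkings v = (Γ.marks {v}).card := by
  rw [numMarkings_eq_sum, marks, Finset.card_filter]
  simp

theorem tri_adj {a b c i j k : ℕ} {S T : Finset (Fin n)} (ha : 1 ≤ a) (hb : 1 ≤ b) (hc : 1 ≤ c)
    (v w : Fin 3) (hvw : v ≠ w) : (tri a b c i j k S T).adjGraph.Adj v w := by
  refine ⟨hvw, ?_⟩
  change ∃ h : Bool × (Fin a ⊕ Fin b ⊕ Fin c), triEnd a b c h = v ∧ triEnd a b c (!h.1, h.2) = w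
  fin_cases v <;> fin_cases w
  · exact absurd rfl hvw
  · exact ⟨(true, .inr (.inr ⟨0, hc⟩)), rfl, rfl⟩
  · exact ⟨(true, .inr (.inl ⟨0, hb⟩)), rfl, rfl⟩
  · exact ⟨(false, .inr (.inr ⟨0, hc⟩)), rfl, rfl⟩
  · exact absurd rfl hvw
  · exact ⟨(true, .inl ⟨0, ha⟩), rfl, rfl⟩
  · exact ⟨(false, .inr (.inl ⟨0, hb⟩)), rfl, rfl⟩
  · exact ⟨(false, .inl ⟨0, ha⟩), rfl, rfl⟩
  · exact absurd rfl hvw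

theorem tri_arithGenus (a b c i j k : ℕ) (S T : Finset (Fin n)) :
    (tri a b c i j k S T).arithGenus = i + j + k + a + b + c - 2 := by
  have h := (tri a b c i j k S T).sum_omega
  have h1 : ∑ v, (tri a b c i j k S T).omega v =
      ∑ v : Fin 3, (2 * ((![i, j, k] v : ℕ) : ℤ) - 2 + ((![b + c, a + c, a + b] v : ℕ) : ℤ)) :=
    Finset.sum_congr rfl fun v _ => tri_omega a b c i j k S T v
  rw [h1, Fin.sum_univ_three] at h
  simp at h
  omega

theorem tri_isStable {a b c i j k : ℕ} {S T : Finset (Fin n)} (hST : Disjoint S T) (ha : 1 ≤ a)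
    (hb : 1 ≤ b) (hc : 1 ≤ c) (hi : i = 0 → 3 ≤ b + c + S.card) (hj : j = 0 → 3 ≤ a + c + T.card)
    (hk : k = 0 → 3 ≤ a + b + (S ∪ T)ᶜ.card) : (tri a b c i j k S T).IsStable := by
  constructor
  · have : Nonempty (tri a b c i j k S T).Vert := ⟨(0 : Fin 3)⟩
    refine SimpleGraph.Connected.mk fun v w => ?_
    by_cases hvw : v = w
    · rw [hvw]
    · exact (tri_adj ha hb hc v w hvw).reachable
  · intro v
    obtain ⟨h0, h1, h2, -⟩ := tri_marks a b c i j k S T hST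
    rw [numMarkings_eq_card_marks]
    revert v
    change ∀ v : Fin 3, ![i, j, k] v = 0 → 3 ≤ (tri a b c i j k S T).valence v +
      ((tri a b c i j k S T).marks ({v} : Finset (Fin 3))).card
    intro v
    rw [tri_valence]
    fin_cases v
    · change i = 0 → 3 ≤ b + c + ((tri a b c i j k S T).marks ({0} : Finset (Fin 3))).card
      rwa [h0]
    · change j = 0 → 3 ≤ a + c + ((tri a b c i j k S T).marks ({1} : Finset (Fin 3))).card
      rwa [h1]
    · change k = 0 → 3 ≤ a + b + ((tri a b c i j k S T).marks ({2} : Finset (Fin 3))).card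
      rwa [h2]

end MarkedGraph

/-! ### Relations between vine values -/

open MarkedGraph

variable {g n : ℕ}

/-- The additivity of vine values given by a triangle. -/
theorem vineValue_add {φ : Family g n} (hφ : φ ∈ stabSpace g n) {a b c i j k : ℕ}
    {S T : Finset (Fin n)} (hST : Disjoint S T) (ha : 1 ≤ a) (hb : 1 ≤ b) (hc : 1 ≤ c)
    (hi : i = 0 → 3 ≤ b + c + S.card) (hj : j = 0 → 3 ≤ a + c + T.card)
    (hk : k = 0 → 3 ≤ a + b + (S ∪ T)ᶜ.card) (hg : i + j + k + a + b + c = g + 2) :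
    vineValue φ (b + c) i S + vineValue φ (a + c) j T =
      vineValue φ (a + b) (i + j + c - 1) (S ∪ T) := by
  let Γ : StableGraph g n := ⟨tri a b c i j k S T, tri_isStable hST ha hb hc hi hj hk, by
    rw [tri_arithGenus]; omega⟩
  obtain ⟨h0, h1, -, h3⟩ := tri_marks a b c i j k S T hST
  have hne : ∀ U : Finset (Fin 3), U.Nonempty → (∃ v, v ∉ U) →
      (tri a b c i j k S T).IsElementary U := fun U h1 h2 =>
    isElementary_of_adj (tri_adj ha hb hc) h1 h2
  have hpair : ∀ {M : Type} [AddCommMonoid M] (f : Fin 3 → M),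
      ∑ v ∈ ({0, 1} : Finset (Fin 3)), f v = f 0 + f 1 := fun f =>
    Finset.sum_pair (by decide)
  have e0 := sum_eq_vineValue hφ Γ (U := ({0} : Finset (Fin 3))) (α := b + c) (i := i) (S := S)
    (hne _ ⟨0, by decide⟩ ⟨1, by decide⟩) (tri_cutSize_zero _ _ _ _ _ _ _ _)
    ((Finset.sum_singleton _ _).trans (by rw [tri_omega]; rfl)) h0
  have e1 := sum_eq_vineValue hφ Γ (U := ({1} : Finset (Fin 3))) (α := a + c) (i := j) (S := T)
    (hne _ ⟨1, by decide⟩ ⟨0, by decide⟩) (tri_cutSize_one _ _ _ _ _ _ _ _)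
    ((Finset.sum_singleton _ _).trans (by rw [tri_omega]; rfl)) h1
  -- Merging the vertices `0` and `1` along `c` edges contracts one edge and turns the other `c - 1`
  -- into loops, whence the genus `i + j + c - 1`.
  have e2 := sum_eq_vineValue hφ Γ (U := ({0, 1} : Finset (Fin 3))) (α := a + b)
    (i := i + j + c - 1) (S := S ∪ T)
    (hne _ ⟨0, by decide⟩ ⟨2, by decide⟩) (tri_cutSize_pair _ _ _ _ _ _ _ _)
    ((hpair _).trans (by
      rw [tri_omega, tri_omega]
      simp
      omega)) h3
  rw [← e0, ← e1, ← e2]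
  exact (congrArg₂ (· + ·) (Finset.sum_singleton _ _) (Finset.sum_singleton _ _)).trans (hpair _).symm

/-- Each additional edge costs one copy of the three-edge value: the triangle with `(a, b, c) = (2,
α - 1, 1)` has cuts of sizes `α`, `3` and `α + 1`. -/
theorem vineValue_empty {φ : Family g n} (hφ : φ ∈ stabSpace g n) {α j : ℕ} (hα : 3 ≤ α)
    (hg : j + α = g + 1) :
    vineValue φ α 0 ∅ = (α - 2) * vineValue φ 3 0 ∅ := by
  induction α, hα using Nat.le_induction generalizing j with
  | base => push_cast; ring
  | succ α hα ih =>
    have h := vineValue_add hφ (a := 2) (b := α - 1) (c := 1) (i := 0) (j := 0) (k := j)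
      (S := ∅) (T := ∅) (by simp) (by omega) (by omega) (by omega) (by simp; omega) (by simp)
      (by omega) (by omega)
    have h1 : α - 1 + 1 = α := by omega
    have h2 : 2 + (α - 1) = α + 1 := by omega
    simp only [h1, h2, Finset.union_empty, zero_add, le_refl, tsub_eq_zero_of_le] at h
    rw [← h, ih (j := j + 1) (by omega)]
    push_cast
    ring

/-- The markings are split off one at a time by triangles with `a = c = 1`, whose cuts have sizes
`α`, `2` and `α`. -/
theorem vineValue_zero {φ : Family g n} (hφ : φ ∈ stabSpace g n) (S : Finset (Fin n)) {α j : ℕ}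
    (hα : 2 ≤ α) (hS : 3 ≤ α + S.card) (hj : j = 0 → 3 ≤ α + Sᶜ.card) (hg : j + α = g + 1) :
    vineValue φ α 0 S = ∑ s ∈ S, vineValue φ 2 0 {s} + (α - 2) * vineValue φ 3 0 ∅ := by
  induction S using Finset.induction_on with
  | empty =>
    rw [Finset.sum_empty, zero_add]
    exact vineValue_empty hφ (by simpa using hS) hg
  | insert s S hs ih =>
    rw [Finset.sum_insert hs]
    rw [Finset.card_insert_of_notMem hs] at hS
    by_cases h3 : 3 ≤ α + S.card
    · have h := vineValue_add hφ (a := 1) (b := α - 1) (c := 1) (i := 0) (j := 0) (k := j)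
        (S := S) (T := {s}) (by simpa using hs) (by omega) (by omega) (by omega) (by omega)
        (by simp) (by
          rw [Finset.union_comm, ← Finset.insert_eq]
          intro h
          have := hj h
          omega) (by omega)
      have h1 : α - 1 + 1 = α := by omega
      have h2 : 1 + (α - 1) = α := by omega
      rw [Finset.union_comm, ← Finset.insert_eq, h1, h2] at h
      have hc : (insert s S)ᶜ.card ≤ Sᶜ.card :=
        Finset.card_le_card (Finset.compl_subset_compl.2 (Finset.subset_insert s S))
      rw [← h, ih h3 (by intro h; have := hj h; omega)]
      ring
    -- The remaining vine, with two edges, genus zero and no marking, is unstable and the induction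
    -- cannot pass through it; here the formula is trivial.
    · obtain rfl : α = 2 := by omega
      obtain rfl : S = ∅ := Finset.card_eq_zero.1 (by omega)
      simp

/-- On vine graphs with at least two edges, elements of the stability space are determined by
their values on the graphs `Γ_j` and on one more graph. -/
theorem vineValue_nonsep {φ : Family g n} (hφ : φ ∈ stabSpace g n) (S : Finset (Fin n))
    {α i j : ℕ} (hα : 2 ≤ α) (hS : i = 0 → 3 ≤ α + S.card) (hj : j = 0 → 3 ≤ α + Sᶜ.card)
    (hg : i + j + α = g + 1) :
    vineValue φ α i S =
      ∑ s ∈ S, vineValue φ 2 0 {s} + (2 * i - 2 + α) * vineValue φ 3 0 ∅ := by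
  induction i generalizing α with
  | zero =>
    rw [vineValue_zero hφ S hα (hS rfl) hj (by omega)]
    push_cast
    ring
  | succ i ih =>
    -- A unit of genus is traded for an edge: the vertex of genus `i` with `α + 1` edges absorbs a
    -- vertex of genus `0` along two edges, which gives genus `i + 1` with `α` edges.
    have h := vineValue_add hφ (a := 1) (b := α - 1) (c := 2) (i := i) (j := 0) (k := j)
      (S := S) (T := ∅) (by simp) (by omega) (by omega) (by omega) (by omega) (by simp)
      (by
        rw [Finset.union_empty]
        intro h
        have := hj h
        omega) (by omega)
    have h1 : α - 1 + 2 = α + 1 := by omega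
    have h2 : 1 + (α - 1) = α := by omega
    rw [h1, h2, Finset.union_empty] at h
    rw [show i + 1 = i + 0 + 2 - 1 by omega, ← h,
      ih (by omega) (by omega) (by intro h; have := hj h; omega) (by omega)]
    push_cast
    ring

end UnivStab
end

noncomputable section
namespace UnivStab
open scoped Classical
namespace MarkedGraph
variable {n : ℕ}

/-! ### Vine graphs and their values -/

theorem vine_isElementary {α i j : ℕ} {S : Finset (Fin n)} (hα : 1 ≤ α) (b : Bool) :
    (vine α i j S).IsElementary ({b} : Finset Bool) := by
  refine isElementary_of_adj (fun v w hvw => ⟨hvw, ?_⟩) ⟨b, Finset.mem_singleton_self b⟩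
    ⟨!b, fun h => Bool.not_ne_self b (Finset.mem_singleton.1 h)⟩
  refine ⟨((v : Bool), (⟨0, hα⟩ : Fin α)), rfl, ?_⟩
  exact (Bool.eq_not.2 (Ne.symm hvw)).symm

theorem vine_cutSize (α i j : ℕ) (S : Finset (Fin n)) (b : Bool) :
    (vine α i j S).cutSize ({b} : Finset Bool) = α := by
  change Nat.card {h : Bool × Fin α // h.1 ∈ ({b} : Finset Bool) ∧ (!h.1) ∉ ({b} : Finset Bool)} = _
  rw [Nat.card_eq_fintype_card, Fintype.card_subtype, Finset.card_filter]
  simp only [Fintype.sum_prod_type, Fintype.sum_bool]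
  cases b <;> simp

theorem vine_omegaSum (α i j : ℕ) (S : Finset (Fin n)) (b : Bool) :
    (vine α i j S).omegaSum ({b} : Finset Bool) = 2 * ((if b then i else j : ℕ) : ℤ) - 2 + α := by
  refine (Finset.sum_singleton _ _).trans ?_
  change 2 * ((if b then i else j : ℕ) : ℤ) - 2 + (((vine α i j S).valence b : ℕ) : ℤ) = _
  rw [vine_valence]

theorem vine_marks (α i j : ℕ) (S : Finset (Fin n)) :
    (vine α i j S).marks ({true} : Finset Bool) = S ∧
      (vine α i j S).marks ({false} : Finset Bool) = Sᶜ := by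
  constructor <;> ext s <;> refine mem_marks.trans (Finset.mem_singleton.trans ?_)
  · exact decide_eq_true_iff
  · exact decide_eq_false_iff_not.trans Finset.mem_compl.symm

theorem IsStable.vine_left {α i j : ℕ} {S : Finset (Fin n)} (h : (vine α i j S).IsStable) :
    i = 0 → 3 ≤ α + S.card := by
  have := h.2 true
  rwa [vine_valence, vine_numMarkings_true] at this

theorem IsStable.vine_right {α i j : ℕ} {S : Finset (Fin n)} (h : (vine α i j S).IsStable) :
    j = 0 → 3 ≤ α + Sᶜ.card := by
  have := h.2 false
  rw [vine_valence, vine_numMarkings_false] at this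
  rwa [Finset.card_compl, Fintype.card_fin]

end MarkedGraph

/-! ### Classification of vine graphs and determination of their values -/

open MarkedGraph

variable {g n : ℕ}

theorem vine_sum_eq {α i j : ℕ} {S : Finset (Fin n)}
    (h : (vine α i j S).IsStable ∧ (vine α i j S).arithGenus = g) : i + j + α = g + 1 := by
  have := h.2
  rw [vine_arithGenus] at this
  omega

theorem vineValue_compl_eq {φ : Family g n} (hφ : φ ∈ stabSpace g n) {α i j : ℕ}
    {S : Finset (Fin n)} (h : (vine α i j S).IsStable ∧ (vine α i j S).arithGenus = g) :
    vineValue φ α j Sᶜ = φ ⟨vine α i j S, h⟩ (false : Bool) := by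
  rw [← sum_eq_vineValue hφ ⟨vine α i j S, h⟩
    (vine_isElementary (one_le_of_vine_isStable h.1) false) (vine_cutSize _ _ _ _ _)
    (by rw [vine_omegaSum]; rfl) (vine_marks _ _ _ _).2]
  exact Finset.sum_singleton _ _

theorem vineValue_add_compl {φ : Family g n} {d : ℝ} (hφ : φ ∈ stabSpaceDeg g n d) {α i j : ℕ}
    {S : Finset (Fin n)} (h : (vine α i j S).IsStable ∧ (vine α i j S).arithGenus = g) :
    vineValue φ α i S + vineValue φ α j Sᶜ = d := by
  rw [vineValue_compl_eq hφ.1 h, vineValue_eq h, ← hφ.2 ⟨vine α i j S, h⟩]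
  exact (Fintype.sum_bool (fun b : Bool => φ ⟨vine α i j S, h⟩ b)).symm

theorem vineValue_sepGraph (φ : Family g n) (p : SepIndex g n) :
    vineValue φ 1 p.1.1.val p.1.2 = φ (sepGraph p) (true : Bool) :=
  vineValue_eq (sepGraph p).2

theorem vineValue_loopGraph (φ : Family g n) (j : LoopIndex g n) :
    vineValue φ 2 0 {j.1} = φ (loopGraph j) (true : Bool) :=
  vineValue_eq (loopGraph j).2

/-- Vine graphs with one edge are the `Γ(i, S)`, up to exchanging the two vertices, except that
their two vertices may be alike when there are no markings. -/
theorem sepIndex_cases {i j : ℕ} {S : Finset (Fin n)}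
    (h : (vine 1 i j S).IsStable ∧ (vine 1 i j S).arithGenus = g) :
    (∃ p : SepIndex g n, p.1.1.val = i ∧ p.1.2 = S) ∨
      (∃ p : SepIndex g n, p.1.1.val = j ∧ p.1.2 = Sᶜ) ∨ (n = 0 ∧ i = j) := by
  have h1 := vine_sum_eq h
  have h2 := h.1.vine_left
  have h3 := h.1.vine_right
  have h4 := Finset.card_add_card_compl S
  rw [Fintype.card_fin] at h4
  -- The condition selects the first vertex by the marking `1`, or by the smaller genus when there
  -- are no markings.
  by_cases hc : (n = 0 → i < g - i) ∧ ∀ h : 0 < n, (⟨0, h⟩ : Fin n) ∈ S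
  · refine Or.inl ⟨⟨(⟨i, by omega⟩, S), fun h => ?_, fun h => ?_, hc⟩, rfl, rfl⟩
    · have := h2 h
      change 2 ≤ S.card
      omega
    · have : i = g := h
      change S.card + 2 ≤ n
      omega
  · right
    by_cases hij : n = 0 ∧ i = j
    · exact Or.inr hij
    · left
      refine ⟨⟨(⟨j, by omega⟩, Sᶜ), fun h => ?_, fun h => ?_, fun hn => ?_, fun hn => ?_⟩, rfl, rfl⟩
      · have := h3 h
        change 2 ≤ Sᶜ.card
        omega
      · have : j = g := h
        change Sᶜ.card + 2 ≤ n
        omega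
      · change j < g - j
        by_contra hlt
        exact hc ⟨fun _ => by omega, fun h => by omega⟩
      · rw [Finset.mem_compl]
        exact fun hm => hc ⟨fun h => by omega, fun _ => hm⟩

/-- The set of markings given by a set of indices. -/
def loopMarks (S : Finset (LoopIndex g n)) : Finset (Fin n) :=
  S.map (Function.Embedding.subtype _)

theorem exists_loopMarks (hg : 1 ≤ g) {S : Finset (Fin n)} (hS : g = 1 → ∀ s ∈ S, s.val ≠ 0) :
    ∃ T : Finset (LoopIndex g n), loopMarks T = S := by
  refine ⟨S.subtype _, ?_⟩
  rw [loopMarks, Finset.subtype_map, Finset.filter_eq_self]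
  exact fun s hs => ⟨hg, fun h => hS h s hs⟩

/-- The coefficient `2g - 2 + δ` is positive. -/
theorem twice_genus_delta_pos (hg : 1 ≤ g) : (0 : ℝ) < 2 * g - 2 + delta g := by
  rw [delta]
  have : (1 : ℝ) ≤ g := by exact_mod_cast hg
  split_ifs with h
  · subst h; norm_num
  · have : (2 : ℝ) ≤ g := by exact_mod_cast (by omega : 2 ≤ g)
    push_cast
    linarith

/-- The vine graphs with at least two edges, up to exchanging the two vertices. -/
theorem loopIndex_cases {α i j : ℕ} {S : Finset (Fin n)} (hα : 2 ≤ α)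
    (h : (vine α i j S).IsStable ∧ (vine α i j S).arithGenus = g) :
    (∃ T : Finset (LoopIndex g n), loopMarks T = S ∧ (2 * i + α : ℤ) < 2 * g + delta g ∧
      ¬ (2 * i + α = 2 ∧ T = ∅)) ∨
    (∃ T : Finset (LoopIndex g n), loopMarks T = Sᶜ ∧ (2 * j + α : ℤ) < 2 * g + delta g ∧
      ¬ (2 * j + α = 2 ∧ T = ∅)) := by
  have h1 := vine_sum_eq h
  have h2 := h.1.vine_left
  have h3 := h.1.vine_right
  have hg : 1 ≤ g := by omega
  have hl : (g = 1 → ∀ s ∈ S, s.val ≠ 0) → (2 * i + α : ℤ) < 2 * g + delta g →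
      ∃ T : Finset (LoopIndex g n), loopMarks T = S ∧ (2 * i + α : ℤ) < 2 * g + delta g ∧
      ¬ (2 * i + α = 2 ∧ T = ∅) := by
    intro hS hlt
    obtain ⟨T, hT⟩ := exists_loopMarks hg hS
    refine ⟨T, hT, hlt, ?_⟩
    rintro ⟨h5, rfl⟩
    have h6 := h2 (by omega)
    rw [← hT] at h6
    simp only [loopMarks, Finset.map_empty, Finset.card_empty] at h6
    omega
  have hr : (g = 1 → ∀ s ∈ Sᶜ, s.val ≠ 0) → (2 * j + α : ℤ) < 2 * g + delta g →
      ∃ T : Finset (LoopIndex g n), loopMarks T = Sᶜ ∧ (2 * j + α : ℤ) < 2 * g + delta g ∧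
      ¬ (2 * j + α = 2 ∧ T = ∅) := by
    intro hS hlt
    obtain ⟨T, hT⟩ := exists_loopMarks hg hS
    refine ⟨T, hT, hlt, ?_⟩
    rintro ⟨h5, rfl⟩
    have h6 := h3 (by omega)
    rw [← hT] at h6
    simp only [loopMarks, Finset.map_empty, Finset.card_empty] at h6
    omega
  -- In genus one both sides have `ℓ = 0`, and the side without the marking `1` is taken. Otherwise
  -- the numbers `2i + α` and `2j + α` of the two sides add up to `2g + 2`, so if one is at least
  -- `2g` the other is at most `2`.
  by_cases hg1 : g = 1
  · have hδ : delta g = 1 := if_pos hg1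
    by_cases hS : ∀ s ∈ S, s.val ≠ 0
    · exact Or.inl (hl (fun _ => hS) (by rw [hδ]; omega))
    · right
      push Not at hS
      obtain ⟨s, hs, hs0⟩ := hS
      refine hr (fun _ t ht ht0 => ?_) (by rw [hδ]; omega)
      rw [Finset.mem_compl] at ht
      exact ht (Fin.ext (ht0.trans hs0.symm) ▸ hs)
  · have hδ : delta g = 0 := if_neg hg1
    by_cases hlt : (2 * i + α : ℤ) < 2 * g + delta g
    · exact Or.inl (hl (fun h => absurd h hg1) hlt)
    · refine Or.inr (hr (fun h => absurd h hg1) ?_)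
      rw [hδ] at hlt ⊢
      omega

/-- The values of stability parameters on vine graphs with at least two edges. -/
theorem vineValue_loopMarks {φ : Family g n} {d : ℝ} (hφ : φ ∈ stabSpaceDeg g n d) {α i j : ℕ}
    (hα : 2 ≤ α) (T : Finset (LoopIndex g n))
    (h : (vine α i j (loopMarks T)).IsStable ∧ (vine α i j (loopMarks T)).arithGenus = g) :
    vineValue φ α i (loopMarks T) = ∑ t ∈ T, φ (loopGraph t) (true : Bool) +
      (2 * i - 2 + α) * (d - ∑ t : LoopIndex g n, φ (loopGraph t) (true : Bool)) /
        (2 * g - 2 + delta g) := by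
  have h1 := vine_sum_eq h
  have h2 := h.1.vine_left
  have h3 := h.1.vine_right
  have key := vineValue_nonsep hφ.1 (loopMarks T) hα h2 h3 h1
  have hsum : ∑ s ∈ loopMarks T, vineValue φ 2 0 {s} = ∑ t ∈ T, φ (loopGraph t) (true : Bool) := by
    rw [loopMarks, Finset.sum_map]
    exact Finset.sum_congr rfl fun t _ => vineValue_loopGraph φ t
  rw [hsum] at key
  rw [key]
  congr 1
  have hgα : (i : ℝ) + j + α = g + 1 := by exact_mod_cast h1
  by_cases hg1 : g = 1
  -- In genus one the coefficient `2i - 2 + α` is zero, so the default value of `vineValue φ 3 0 ∅`,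
  -- whose graph has genus two, is irrelevant.
  · have h4 : i = 0 := by omega
    have h5 : α = 2 := by omega
    rw [h4, h5]
    norm_num
  · have hg2 : 2 ≤ g := by omega
    have key' := vineValue_nonsep hφ.1 (loopMarks T)ᶜ (i := j) (j := i) hα h3
      (by rwa [compl_compl]) (by omega)
    have htot := vineValue_add_compl hφ h
    have hall : ∑ s : Fin n, vineValue φ 2 0 {s} =
        ∑ t : LoopIndex g n, φ (loopGraph t) (true : Bool) := by
      refine (Fintype.sum_equiv (Equiv.subtypeUnivEquiv fun s => ?_) _ _ fun t => ?_).symm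
      · exact ⟨by omega, fun h => absurd h hg1⟩
      · exact (vineValue_loopGraph φ t).symm
    rw [← Finset.sum_add_sum_compl (loopMarks T), hsum] at hall
    have hpos := twice_genus_delta_pos (g := g) (by omega)
    have hδ : (delta g : ℝ) = 0 := by rw [delta, if_neg hg1, Nat.cast_zero]
    rw [hδ] at hpos ⊢
    -- The total degree fixes the last unknown: adding the formulas for both sides, the coefficients
    -- `2i - 2 + α` and `2j - 2 + α` sum to `2g - 2`.
    have ht : (2 * (g : ℝ) - 2) * vineValue φ 3 0 ∅ =
        d - ∑ t : LoopIndex g n, φ (loopGraph t) (true : Bool) := by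
      rw [← hall, ← htot, key, key']
      have : (g : ℝ) = i + j + α - 1 := by linarith
      rw [this]
      ring
    rw [← ht, add_zero]
    rw [add_zero] at hpos
    rw [mul_left_comm, mul_div_cancel_left₀ _ hpos.ne']

/-! ### Injectivity -/

/-- The sum is split along the connected components of the graph with `v` removed. Such a component
has connected complement: a walk to `v` that starts outside it cannot enter it before meeting `v`.
-/
theorem sum_ne_eq_zero_of_elementary {V : Type*} [Fintype V] {G : SimpleGraph V} (hG : G.Connected)
    (v : V) (ψ : V → ℝ)
    (hψ : ∀ U : Finset V, (G.induce (U : Set V)).Connected →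
      (G.induce ((U : Set V)ᶜ)).Connected → ∑ w ∈ U, ψ w = 0) :
    ∑ w : {w // w ≠ v}, ψ w = 0 := by
  let s : Set V := {w | w ≠ v}
  let G' : SimpleGraph s := G.induce s
  have : Fintype G'.ConnectedComponent := Fintype.ofFinite _
  change ∑ w : s, ψ w = 0
  rw [← Finset.sum_fiberwise Finset.univ (fun w : s => G'.connectedComponentMk w)]
  refine Finset.sum_eq_zero fun c _ => ?_
  let U : Finset V := (Finset.univ.filter fun w : s => G'.connectedComponentMk w = c).map
    (Function.Embedding.subtype _)
  have hU : ∀ w : s, w.1 ∈ U ↔ G'.connectedComponentMk w = c := by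
    intro w
    simp only [U, Finset.mem_map, Finset.mem_filter, Finset.mem_univ, true_and]
    constructor
    · rintro ⟨w', hw', h⟩
      rwa [← Subtype.ext h]
    · exact fun h => ⟨w, h, rfl⟩
  have hvU : v ∉ U := by
    simp only [U, Finset.mem_map, Finset.mem_filter, Finset.mem_univ, true_and]
    rintro ⟨w, -, h⟩
    exact w.2 h
  have key : ∑ w ∈ U, ψ w = 0 := by
    refine hψ U ?_ ?_
    · refine preconnected_induce_image (G := G') (H := G) Subtype.val
        (fun a b hab => Or.inr (SimpleGraph.comap_adj.1 hab)) (s := c.supp) ?_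
        c.connected_toSimpleGraph
      ext w
      simp only [Set.mem_image, SimpleGraph.ConnectedComponent.mem_supp_iff, Finset.mem_coe]
      constructor
      · rintro ⟨w, hw, rfl⟩
        exact (hU w).2 hw
      · intro hw
        have hwv : w ≠ v := fun h => hvU (h ▸ hw)
        exact ⟨⟨w, hwv⟩, (hU ⟨w, hwv⟩).1 hw, rfl⟩
    · have hreach : ∀ (w u : V) (_ : G.Walk w u) (hu : u = v) (hw : w ∉ U),
          (G.induce ((U : Set V)ᶜ)).Reachable ⟨w, hw⟩ ⟨v, hvU⟩ := by
        intro w u p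
        induction p with
        | nil => rintro rfl hw; exact SimpleGraph.Reachable.refl _
        | @cons w w' u hadj p ih =>
          intro hu hw
          by_cases hwv : w = v
          · subst hwv; exact SimpleGraph.Reachable.refl _
          · have hw' : w' ∉ U := by
              intro hw'
              have hwv' : w' ≠ v := fun h => hvU (h ▸ hw')
              refine hw ((hU ⟨w, hwv⟩).2 ?_)
              rw [← (hU ⟨w', hwv'⟩).1 hw', SimpleGraph.ConnectedComponent.eq]
              exact SimpleGraph.Adj.reachable (SimpleGraph.comap_adj.2 hadj)
            refine SimpleGraph.Reachable.trans ?_ (ih hu hw')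
            exact SimpleGraph.Adj.reachable (SimpleGraph.comap_adj.2 hadj)
      have : Nonempty ((U : Set V)ᶜ : Set V) := ⟨⟨v, hvU⟩⟩
      refine SimpleGraph.Connected.mk ?_
      rintro ⟨a, ha⟩ ⟨b, hb⟩
      obtain ⟨p⟩ := hG.preconnected a v
      obtain ⟨q⟩ := hG.preconnected b v
      exact (hreach a v p rfl ha).trans (hreach b v q rfl hb).symm
  rwa [Finset.sum_map] at key

/-- A stability parameter of degree zero vanishing on the graphs `Γ(i, S)` and `Γ_j` is zero. -/
theorem eq_zero_of_restrict {ψ : Family g n} (hψ : ψ ∈ stabSpaceDeg g n 0)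
    (hC : ∀ p : SepIndex g n, ψ (sepGraph p) (true : Bool) = 0)
    (hD : ∀ j : LoopIndex g n, ψ (loopGraph j) (true : Bool) = 0) : ψ = 0 := by
  have hvine : ∀ (α i j : ℕ) (S : Finset (Fin n)) (_ : (vine α i j S).IsStable ∧
      (vine α i j S).arithGenus = g), vineValue ψ α i S = 0 := by
    intro α i j S h
    have hadd := vineValue_add_compl hψ h
    by_cases hα : 2 ≤ α
    · have hval : ∀ (i j : ℕ) (T : Finset (LoopIndex g n)) (_ : (vine α i j (loopMarks T)).IsStable ∧
          (vine α i j (loopMarks T)).arithGenus = g), vineValue ψ α i (loopMarks T) = 0 := by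
        intro i j T h
        rw [vineValue_loopMarks hψ hα T h]
        simp [hD]
      rcases loopIndex_cases hα h with ⟨T, rfl, -⟩ | ⟨T, hT, -⟩
      · exact hval i j T h
      · have h1 : (vine α j i (loopMarks T)).IsStable ∧
            (vine α j i (loopMarks T)).arithGenus = g := by
          refine ⟨vine_isStable _ _ _ _ (by omega) ?_ ?_, ?_⟩
          · rw [hT]
            exact h.1.vine_right
          · have := h.1.vine_left
            rw [hT, Finset.card_compl, Fintype.card_fin, Nat.sub_sub_self (by
              simpa using Finset.card_le_univ S)]
            exact this
          · have := vine_sum_eq h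
            rw [vine_arithGenus]
            omega
        have h2 := hval j i T h1
        rw [hT] at h2
        linarith
    · have h1 := one_le_of_vine_isStable h.1
      obtain rfl : α = 1 := by omega
      rcases sepIndex_cases h with ⟨p, rfl, rfl⟩ | ⟨p, rfl, hp⟩ | ⟨rfl, rfl⟩
      · rw [vineValue_sepGraph, hC]
      · rw [← hp, vineValue_sepGraph, hC, add_zero] at hadd
        exact hadd
      -- The symmetric vine takes equal values at its two vertices, and they add up to zero.
      · rw [Subsingleton.elim Sᶜ S] at hadd
        linarith
  funext Γ v
  have h1 := sum_ne_eq_zero_of_elementary Γ.2.1.1 v (ψ Γ) fun U h1 h2 => by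
    obtain ⟨α, i, j, S, h, -, -, -, h3⟩ := exists_vine Γ ⟨h1, h2⟩
    exact (h3 ψ hψ.1).trans ((vineValue_eq h).symm.trans (hvine α i j S h))
  have h2 := hψ.2 Γ
  rw [Fintype.sum_eq_add_sum_subtype_ne _ v, h1, add_zero] at h2
  exact h2

end UnivStab
end

noncomputable section
namespace UnivStab
open scoped Classical
namespace MarkedGraph
variable {n : ℕ}

/-! ### Explicit stability parameters -/

theorem Iso.valence_comm {Γ Γ' : MarkedGraph n} (f : Iso Γ Γ') (v : Γ.Vert) :
    Γ'.valence (f.vert v) = Γ.valence v := by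
  rw [valence_eq_sum, valence_eq_sum, ← Equiv.sum_comp f.half]
  simp only [← f.endpoint_comm, f.vert.apply_eq_iff_eq]

theorem Iso.omega_comm {Γ Γ' : MarkedGraph n} (f : Iso Γ Γ') (v : Γ.Vert) :
    Γ'.omega (f.vert v) = Γ.omega v := by
  rw [omega, omega, f.valence_comm, f.genus_comm]

theorem Iso.cutSize_comm {Γ Γ' : MarkedGraph n} (f : Iso Γ Γ') (U : Finset Γ.Vert) :
    Γ'.cutSize (U.map f.vert.toEmbedding) = Γ.cutSize U := by
  rw [cutSize_eq_sum, cutSize_eq_sum, ← Equiv.sum_comp f.half]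
  simp only [← f.inv_comm, ← f.endpoint_comm]
  simp

theorem Iso.omegaSum_comm {Γ Γ' : MarkedGraph n} (f : Iso Γ Γ') (U : Finset Γ.Vert) :
    Γ'.omegaSum (U.map f.vert.toEmbedding) = Γ.omegaSum U := by
  rw [omegaSum, omegaSum, Finset.sum_map]
  exact Finset.sum_congr rfl fun v _ => f.omega_comm v

theorem Iso.marks_comm {Γ Γ' : MarkedGraph n} (f : Iso Γ Γ') (U : Finset Γ.Vert) :
    Γ'.marks (U.map f.vert.toEmbedding) = Γ.marks U := by
  ext j
  rw [mem_marks, mem_marks, ← f.marking_comm]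
  simp

/-- The half-edge `h` leaves `U`. -/
def Leaves (Γ : MarkedGraph n) (U : Finset Γ.Vert) (h : Γ.HalfEdge) : Prop :=
  Γ.endpoint h ∈ U ∧ Γ.endpoint (Γ.inv h) ∉ U

/-- The contribution of the separating edges at `v`, where the side of a separating edge
contributes a function `b` of its dualizing degree and of its markings. -/
def sepTerm (b : ℤ → Finset (Fin n) → ℝ) (Γ : MarkedGraph n) (v : Γ.Vert) : ℝ :=
  ∑ U : Finset Γ.Vert, if Γ.cutSize U = 1 ∧ ∃ h, Γ.endpoint h = v ∧ Γ.Leaves U h then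
    b (Γ.omegaSum U) (Γ.marks U) else 0

theorem Iso.sepTerm_comm {Γ Γ' : MarkedGraph n} (f : Iso Γ Γ')
    (b : ℤ → Finset (Fin n) → ℝ) (v : Γ.Vert) :
    sepTerm b Γ' (f.vert v) = sepTerm b Γ v := by
  rw [sepTerm, sepTerm, ← Equiv.sum_comp f.vert.finsetCongr]
  refine Finset.sum_congr rfl fun U _ => ?_
  rw [Equiv.finsetCongr_apply, f.cutSize_comm, f.omegaSum_comm, f.marks_comm]
  refine if_congr (and_congr_right fun _ => ?_) rfl rfl
  rw [← f.half.exists_congr_right]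
  simp only [Leaves, ← f.inv_comm, ← f.endpoint_comm]
  simp

theorem exists_unique_leaves {Γ : MarkedGraph n} {U : Finset Γ.Vert} (hU : Γ.cutSize U = 1) :
    ∃ h₀, ∀ h, Γ.Leaves U h ↔ h = h₀ := by
  obtain ⟨h1, ⟨h0, h2⟩⟩ := Nat.card_eq_one_iff_unique.1 hU
  refine ⟨h0, fun h => ⟨fun hh => ?_, ?_⟩⟩
  · exact congrArg Subtype.val (h1.elim ⟨h, hh⟩ ⟨h0, h2⟩)
  · rintro rfl
    exact h2

/-- A set with cut size one has a unique leaving half-edge, so it contributes at only one vertex. -/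
theorem sum_sepTerm (b : ℤ → Finset (Fin n) → ℝ) (Γ : MarkedGraph n) (s : Finset Γ.Vert) :
    ∑ v ∈ s, sepTerm b Γ v = ∑ U : Finset Γ.Vert,
      if Γ.cutSize U = 1 ∧ ∃ h, Γ.endpoint h ∈ s ∧ Γ.Leaves U h then
        b (Γ.omegaSum U) (Γ.marks U) else 0 := by
  simp only [sepTerm]
  rw [Finset.sum_comm]
  refine Finset.sum_congr rfl fun U _ => ?_
  by_cases hU : Γ.cutSize U = 1
  · obtain ⟨h0, hh0⟩ := exists_unique_leaves hU
    simp [hU, hh0]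
  · simp [hU]

/-- Complementation has no fixed point on the subsets of a nonempty type, so the terms cancel in
pairs. -/
theorem sum_eq_zero_of_compl {V : Type*} [Fintype V] [Nonempty V] (s : Finset (Finset V))
    (F : Finset V → ℝ) (hs : ∀ U ∈ s, Uᶜ ∈ s) (hF : ∀ U ∈ s, F U + F Uᶜ = 0) :
    ∑ U ∈ s, F U = 0 := by
  refine Finset.sum_involution (fun U _ => Uᶜ) hF (fun U _ _ h => ?_) hs
    (fun U _ => compl_compl U)
  obtain ⟨v⟩ := ‹Nonempty V›
  have := Finset.ext_iff.1 h v
  rw [Finset.mem_compl] at this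
  tauto

theorem leaves_compl {Γ : MarkedGraph n} {U : Finset Γ.Vert} {h : Γ.HalfEdge} :
    Γ.Leaves Uᶜ h ↔ Γ.Leaves U (Γ.inv h) := by
  simp only [Leaves, Finset.mem_compl, not_not, Γ.inv_inv]
  exact and_comm

theorem omegaSum_compl (Γ : MarkedGraph n) (U : Finset Γ.Vert) :
    Γ.omegaSum Uᶜ = 2 * Γ.arithGenus - 2 - Γ.omegaSum U := by
  rw [← omegaSum_add_compl Γ U]
  ring

theorem sum_sepTerm_univ {b : ℤ → Finset (Fin n) → ℝ} {Γ : MarkedGraph n} [Nonempty Γ.Vert]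
    (hb : ∀ w S, b (2 * Γ.arithGenus - 2 - w) Sᶜ = -b w S) : ∑ v, sepTerm b Γ v = 0 := by
  rw [sum_sepTerm]
  refine sum_eq_zero_of_compl _ _ (fun U _ => Finset.mem_univ _) fun U _ => ?_
  rw [cutSize_compl, omegaSum_compl, marks_compl, hb]
  have : (∃ h, Γ.endpoint h ∈ Finset.univ ∧ Γ.Leaves Uᶜ h) ↔
      ∃ h, Γ.endpoint h ∈ Finset.univ ∧ Γ.Leaves U h := by
    simp only [leaves_compl, Finset.mem_univ, true_and]
    exact Γ.invEquiv.exists_congr_right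
  simp only [this]
  split_ifs <;> simp

theorem pullback_injective (Γ : MarkedGraph n) (h : Γ.HalfEdge) :
    Function.Injective (Γ.pullback h) := by
  intro U U' hUU'
  ext w
  obtain ⟨v, rfl⟩ := Γ.contractVert_surjective h w
  rw [← mem_pullback, hUU', mem_pullback]

theorem exists_pullback {Γ : MarkedGraph n} {h : Γ.HalfEdge} {U : Finset Γ.Vert}
    (hU : Γ.endpoint h ∈ U ↔ Γ.endpoint (Γ.inv h) ∈ U) : ∃ U', Γ.pullback h U' = U := by
  refine ⟨U.image (Γ.contractVert h), ?_⟩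
  ext v
  rw [mem_pullback, Finset.mem_image]
  constructor
  · rintro ⟨u, hu, huv⟩
    rcases (contractVert_eq_iff _ _ _ _).1 huv with rfl | ⟨rfl | rfl, rfl | rfl⟩ <;> tauto
  · exact fun hv => ⟨v, hv, rfl⟩

/-- Sets not separating the ends of the contracted edge correspond to sets of vertices of the
contraction, with the same data. A set with cut size one that separates them is a side of the
contracted edge itself; its contribution cancels with that of its complement, as both ends merge and
`b` is antisymmetric. -/
theorem sepTerm_contract {b : ℤ → Finset (Fin n) → ℝ} {Γ : MarkedGraph n}
    (hb : ∀ w S, b (2 * Γ.arithGenus - 2 - w) Sᶜ = -b w S) (h : Γ.HalfEdge)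
    (w : (Γ.contract h).Vert) :
    sepTerm b (Γ.contract h) w = ∑ v with Γ.contractVert h v = w, sepTerm b Γ v := by
  have : Nonempty Γ.Vert := ⟨Γ.endpoint h⟩
  rw [sum_sepTerm, ← Finset.sum_filter_add_sum_filter_not _
    (fun U => Γ.endpoint h ∈ U ↔ Γ.endpoint (Γ.inv h) ∈ U)]
  have hns : ∑ U : Finset Γ.Vert with ¬ (Γ.endpoint h ∈ U ↔ Γ.endpoint (Γ.inv h) ∈ U),
      (if Γ.cutSize U = 1 ∧ ∃ x, Γ.endpoint x ∈ Finset.univ.filter (fun v =>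
        Γ.contractVert h v = w) ∧ Γ.Leaves U x then b (Γ.omegaSum U) (Γ.marks U) else 0) = 0 := by
    refine sum_eq_zero_of_compl _ _ (fun U hU => ?_) fun U hU => ?_
    · rw [Finset.mem_filter] at hU ⊢
      simp only [Finset.mem_univ, true_and, Finset.mem_compl] at hU ⊢
      tauto
    · rw [cutSize_compl, omegaSum_compl, marks_compl, hb]
      by_cases hcut : Γ.cutSize U = 1
      -- The only half-edge leaving `U` belongs to the contracted edge, so both its ends map to the
      -- merged vertex.
      · have key : ∀ x, Γ.Leaves U x → Γ.contractVert h (Γ.endpoint x) =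
            Γ.contractVert h (Γ.endpoint h) ∧ Γ.contractVert h (Γ.endpoint (Γ.inv x)) =
            Γ.contractVert h (Γ.endpoint h) := by
          obtain ⟨h0, hh0⟩ := exists_unique_leaves hcut
          have h1 : Γ.Leaves U h ∨ Γ.Leaves U (Γ.inv h) := by
            rw [Finset.mem_filter] at hU
            simp only [Leaves, Γ.inv_inv]
            tauto
          intro x hx
          rw [(hh0 x).1 hx]
          rcases h1 with h1 | h1 <;> rw [← (hh0 _).1 h1]
          · exact ⟨rfl, contractVert_endpoint_inv _ _⟩
          · rw [Γ.inv_inv]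
            exact ⟨contractVert_endpoint_inv _ _, rfl⟩
        have hiff : (∃ x, Γ.endpoint x ∈ Finset.univ.filter (fun v => Γ.contractVert h v = w) ∧
            Γ.Leaves Uᶜ x) ↔ ∃ x, Γ.endpoint x ∈ Finset.univ.filter (fun v =>
              Γ.contractVert h v = w) ∧ Γ.Leaves U x := by
          simp only [Finset.mem_filter, Finset.mem_univ, true_and, leaves_compl]
          constructor
          · rintro ⟨x, hx, hl⟩
            refine ⟨_, ?_, hl⟩
            rw [← hx, (key _ hl).1, ← (key _ hl).2, Γ.inv_inv]
          · rintro ⟨x, hx, hl⟩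
            refine ⟨Γ.inv x, ?_, by rwa [Γ.inv_inv]⟩
            rw [← hx, (key _ hl).1, (key _ hl).2]
        simp only [hiff]
        split_ifs <;> simp
      · simp [hcut]
  rw [hns, add_zero, sepTerm]
  refine Finset.sum_bij (fun U _ => Γ.pullback h U) (fun U _ => ?_)
    (fun U _ U' _ hUU' => Γ.pullback_injective h hUU') (fun U hU => ?_) (fun U _ => ?_)
  · simp [mem_pullback, contractVert_endpoint_inv]
  · obtain ⟨U', hU'⟩ := exists_pullback (Finset.mem_filter.1 hU).2
    exact ⟨U', Finset.mem_univ _, hU'⟩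
  · rw [cutSize_pullback, omegaSum_pullback, marks_pullback]
    refine if_congr (and_congr_right fun _ => ?_) rfl rfl
    simp only [Leaves, Finset.mem_filter, Finset.mem_univ, true_and, mem_pullback]
    constructor
    · rintro ⟨x, hx, hl⟩
      exact ⟨x.1, hx, hl⟩
    · rintro ⟨x, hx, hl⟩
      refine ⟨⟨x, ?_, ?_⟩, hx, hl⟩
      · rintro rfl
        rw [contractVert_endpoint_inv] at hl
        exact hl.2 hl.1
      · rintro rfl
        rw [Γ.inv_inv, contractVert_endpoint_inv] at hl
        exact hl.2 hl.1

/-- The explicit stability parameters: `y j` for each marking `j` on `v`, a multiple of the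
dualizing degree of `v`, and contributions of the separating edges at `v`. -/
def linearParam (y : Fin n → ℝ) (κ : ℝ) (b : ℤ → Finset (Fin n) → ℝ) (Γ : MarkedGraph n)
    (v : Γ.Vert) : ℝ :=
  ∑ j, (if Γ.marking j = v then y j else 0) + κ * Γ.omega v + sepTerm b Γ v

theorem linearParam_contract (y : Fin n → ℝ) (κ : ℝ) {b : ℤ → Finset (Fin n) → ℝ}
    {Γ : MarkedGraph n} (hb : ∀ w S, b (2 * Γ.arithGenus - 2 - w) Sᶜ = -b w S) (h : Γ.HalfEdge)
    (w : (Γ.contract h).Vert) :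
    linearParam y κ b (Γ.contract h) w =
      ∑ v with Γ.contractVert h v = w, linearParam y κ b Γ v := by
  simp only [linearParam, Finset.sum_add_distrib]
  rw [sepTerm_contract hb, omega_contract, ← Finset.mul_sum, Int.cast_sum, Finset.sum_comm]
  congr 2
  refine Finset.sum_congr rfl fun j _ => ?_
  simp only [Finset.sum_ite_eq, Finset.mem_filter, Finset.mem_univ, true_and]
  rfl

theorem Iso.linearParam_comm {Γ Γ' : MarkedGraph n} (f : Iso Γ Γ') (y : Fin n → ℝ) (κ : ℝ)
    (b : ℤ → Finset (Fin n) → ℝ) (v : Γ.Vert) :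
    linearParam y κ b Γ' (f.vert v) = linearParam y κ b Γ v := by
  rw [linearParam, linearParam, f.sepTerm_comm, f.omega_comm]
  simp only [← f.marking_comm, f.vert.apply_eq_iff_eq]

theorem sum_linearParam (y : Fin n → ℝ) (κ : ℝ) {b : ℤ → Finset (Fin n) → ℝ}
    {Γ : MarkedGraph n} [Nonempty Γ.Vert]
    (hb : ∀ w S, b (2 * Γ.arithGenus - 2 - w) Sᶜ = -b w S) :
    ∑ v, linearParam y κ b Γ v = ∑ j, y j + κ * (2 * Γ.arithGenus - 2) := by
  simp only [linearParam, Finset.sum_add_distrib]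
  rw [sum_sepTerm_univ hb, ← Finset.mul_sum, ← Int.cast_sum, sum_omega, Finset.sum_comm]
  simp

/-- Only the first vertex alone has a leaving half-edge there, and its cut has size `α`. Hence the
function `b` can be tuned on one-edge vines without changing the values on the graphs `Γ_j`. -/
theorem vine_sepTerm (b : ℤ → Finset (Fin n) → ℝ) {α : ℕ} (hα : 1 ≤ α) (i j : ℕ)
    (S : Finset (Fin n)) :
    sepTerm b (vine α i j S) (true : Bool) = if α = 1 then b (2 * i - 1) S else 0 := by
  refine (Finset.sum_eq_single ({true} : Finset Bool) (fun U _ hU => if_neg ?_)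
    (fun h => absurd (Finset.mem_univ _) h)).trans ?_
  · rintro ⟨-, h, hh, hl1, hl2⟩
    refine hU ?_
    rw [hh] at hl1
    have h3 : (vine α i j S).endpoint ((vine α i j S).inv h) = (false : Bool) :=
      congrArg not hh
    rw [h3] at hl2
    ext v
    cases v
    · exact ⟨fun h => absurd h hl2, fun h => absurd (Finset.mem_singleton.1 h) (by decide)⟩
    · exact ⟨fun _ => Finset.mem_singleton_self _, fun _ => hl1⟩
  · rw [vine_cutSize, vine_omegaSum, (vine_marks α i j S).1]
    by_cases h1 : α = 1
    · subst h1
      rw [if_pos, if_pos rfl]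
      · congr 1
        simp
        ring
      · refine ⟨rfl, ((true, ⟨0, hα⟩) : Bool × Fin 1), rfl, Finset.mem_singleton_self _, ?_⟩
        exact fun h => Bool.false_ne_true (Finset.mem_singleton.1 h)
    · rw [if_neg (fun h => h1 h.1), if_neg h1]

theorem vine_linearParam (y : Fin n → ℝ) (κ : ℝ) (b : ℤ → Finset (Fin n) → ℝ) {α : ℕ}
    (hα : 1 ≤ α) (i j : ℕ) (S : Finset (Fin n)) :
    linearParam y κ b (vine α i j S) (true : Bool) =
      ∑ s ∈ S, y s + κ * (2 * i - 2 + α) + if α = 1 then b (2 * i - 1) S else 0 := by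
  refine congrArg₂ (· + ·) (congrArg₂ (· + ·) ?_ ?_) (vine_sepTerm b hα i j S)
  · rw [← Finset.sum_filter]
    refine Finset.sum_congr ?_ fun _ _ => rfl
    ext s
    exact Finset.mem_filter.trans ((and_iff_right (Finset.mem_univ _)).trans decide_eq_true_iff)
  · have h1 : (vine α i j S).omega (true : Bool) = 2 * i - 2 + α := by
      change 2 * (i : ℤ) - 2 + (((vine α i j S).valence (true : Bool) : ℕ) : ℤ) = _
      rw [vine_valence]
    rw [h1]
    push_cast
    rfl

end MarkedGraph

open MarkedGraph

variable {g n : ℕ}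

theorem linearParam_mem {d : ℝ} (y : Fin n → ℝ) (κ : ℝ) {b : ℤ → Finset (Fin n) → ℝ}
    (hb : ∀ w S, b (2 * (g : ℤ) - 2 - w) Sᶜ = -b w S) (hd : ∑ j, y j + κ * (2 * g - 2) = d) :
    (fun Γ => linearParam y κ b Γ.1 : Family g n) ∈ stabSpaceDeg g n d := by
  refine ⟨⟨fun Γ Γ' f v => f.linearParam_comm y κ b v, fun Γ Γ' c w => ?_⟩, fun Γ => ?_⟩
  · obtain ⟨q, rfl⟩ := c.iso.vert.surjective w
    refine (c.iso.linearParam_comm y κ b q).trans ?_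
    rw [linearParam_contract y κ (by rwa [Γ.2.2])]
    refine Finset.sum_congr ?_ fun _ _ => rfl
    ext v
    rw [Finset.mem_filter, Finset.mem_filter]
    exact and_congr_right fun _ => (c.iso.vert.apply_eq_iff_eq).symm
  · have : Nonempty Γ.1.Vert := Γ.2.1.1.nonempty
    rw [sum_linearParam y κ (by rwa [Γ.2.2]), Γ.2.2]
    exact_mod_cast hd

end UnivStab
end

noncomputable section
namespace UnivStab
open scoped Classical
open MarkedGraph

variable {g n : ℕ}

/-! ### The affine isomorphism -/

theorem canonicalParam_vine (d : ℝ) {α i j : ℕ} {S : Finset (Fin n)}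
    (h : (vine α i j S).IsStable ∧ (vine α i j S).arithGenus = g) :
    canonicalParam g n d ⟨vine α i j S, h⟩ (true : Bool) =
      if 2 ≤ g then d / (2 * g - 2) * (2 * i - 2 + α)
      else if ∃ h : 0 < n, (⟨0, h⟩ : Fin n) ∈ S then d else 0 := by
  have h1 : (((vine α i j S).valence (true : Bool) : ℕ) : ℝ) = α := by rw [vine_valence]
  by_cases hg : 2 ≤ g
  · rw [if_pos hg, ← h1]
    exact if_pos hg
  · rw [if_neg hg]
    refine (if_neg hg).trans (if_congr ?_ rfl rfl)
    exact exists_congr fun h => decide_eq_true_iff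

/-- Written as an explicit parameter without separating terms, the canonical parameter inherits its
compatibilities from `linearParam_mem`. -/
theorem canonicalParam_eq (d : ℝ) :
    canonicalParam g n d = fun (Γ : StableGraph g n) => linearParam
      (fun j => if 2 ≤ g then 0 else if j.val = 0 then d else 0)
      (if 2 ≤ g then d / (2 * g - 2) else 0) (fun _ _ => 0) Γ.1 := by
  funext Γ v
  rw [canonicalParam, linearParam, sepTerm]
  by_cases hg : 2 ≤ g
  · simp [hg, omega]
  · simp only [hg, if_false, zero_mul, add_zero, ite_self, Finset.sum_const_zero]
    by_cases hn : 0 < n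
    · rw [Finset.sum_eq_single (⟨0, hn⟩ : Fin n)]
      · simp [hn]
      · intro j _ hj
        have : j.val ≠ 0 := fun h => hj (Fin.ext h)
        simp [this]
      · exact fun h => absurd (Finset.mem_univ _) h
    · obtain rfl : n = 0 := by omega
      simp

theorem sum_ite_val_eq_zero (hn : 0 < n) (d : ℝ) :
    ∑ j : Fin n, (if j.val = 0 then d else 0) = d := by
  rw [Finset.sum_eq_single (⟨0, hn⟩ : Fin n)]
  · simp
  · intro j _ hj
    exact if_neg fun h => hj (Fin.ext h)
  · exact fun h => absurd (Finset.mem_univ _) h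

theorem canonicalParam_mem (hgn : 2 < 2 * g + n) (d : ℝ) :
    canonicalParam g n d ∈ stabSpaceDeg g n d := by
  rw [canonicalParam_eq]
  refine linearParam_mem _ _ (by simp) ?_
  by_cases hg : 2 ≤ g
  · have : (2 : ℝ) ≤ g := by exact_mod_cast hg
    have : (2 * (g : ℝ) - 2) ≠ 0 := by linarith
    simp [hg, this]
  · simp only [hg, if_false, zero_mul, add_zero]
    exact sum_ite_val_eq_zero (by omega) d

theorem degZero_vine_ext {α i j : ℕ} {S : Finset (Fin n)} {a b : (vine α i j S).degZero}
    (h : a.1 (true : Bool) = b.1 (true : Bool)) : a = b := by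
  have ha : a.1 (true : Bool) + a.1 (false : Bool) = 0 :=
    (Fintype.sum_bool (fun v : Bool => a.1 v)).symm.trans a.2
  have hb : b.1 (true : Bool) + b.1 (false : Bool) = 0 :=
    (Fintype.sum_bool (fun v : Bool => b.1 v)).symm.trans b.2
  refine Subtype.ext (funext fun v => ?_)
  revert v
  change ∀ v : Bool, a.1 v = b.1 v
  rintro (_ | _)
  · linarith
  · exact h

theorem sum_eq_zero_of_mem_direction {d : ℝ} {c : Family g n}
    (hc : c ∈ (stabSpaceDeg g n d).direction) (Γ : StableGraph g n) : ∑ v, c Γ v = 0 := by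
  by_cases hne : (stabSpaceDeg g n d : Set (Family g n)).Nonempty
  · obtain ⟨p, hp, q, hq, rfl⟩ := (AffineSubspace.mem_direction_iff_eq_vsub hne c).1 hc
    simp only [vsub_eq_sub, Pi.sub_apply, Finset.sum_sub_distrib]
    rw [hp.2, hq.2, sub_self]
  · rw [Set.not_nonempty_iff_eq_empty, AffineSubspace.coe_eq_bot_iff] at hne
    rw [hne, AffineSubspace.direction_bot, Submodule.mem_bot] at hc
    simp [hc]

/-- The map `(π_C, π_D)` as an affine map. -/
def toCD (g n : ℕ) (d : ℝ) [Nonempty (stabSpaceDeg g n d)] :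
    stabSpaceDeg g n d →ᵃ[ℝ] CSpace g n × DSpace g n where
  toFun φ := (toC φ, toD φ)
  linear :=
    { toFun := fun c => (fun p => ⟨c.1 (sepGraph p), sum_eq_zero_of_mem_direction c.2 _⟩,
        fun j => ⟨c.1 (loopGraph j), sum_eq_zero_of_mem_direction c.2 _⟩)
      map_add' := fun _ _ => rfl
      map_smul' := fun _ _ => rfl }
  map_vadd' φ c := by
    refine Prod.ext (funext fun p => Subtype.ext ?_) (funext fun p => Subtype.ext ?_)
    · exact add_sub_assoc (c.1 (sepGraph p)) (φ.1 (sepGraph p)) _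
    · exact add_sub_assoc (c.1 (loopGraph p)) (φ.1 (loopGraph p)) _

theorem toCD_injective (d : ℝ) [Nonempty (stabSpaceDeg g n d)] :
    Function.Injective (toCD g n d) := by
  intro φ φ' h
  have hC : ∀ p, toC φ p = toC φ' p := fun p => congrFun (congrArg Prod.fst h) p
  have hD : ∀ p, toD φ p = toD φ' p := fun p => congrFun (congrArg Prod.snd h) p
  refine Subtype.ext (sub_eq_zero.1 (eq_zero_of_restrict (g := g) (n := n)
    ⟨sub_mem φ.2.1 φ'.2.1, fun Γ => ?_⟩ (fun p => ?_) (fun p => ?_)))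
  · simp only [Pi.sub_apply, Finset.sum_sub_distrib]
    rw [φ.2.2, φ'.2.2, sub_self]
  · have h1 : φ.1 (sepGraph p) (true : Bool) - canonicalParam g n d (sepGraph p) (true : Bool) =
        φ'.1 (sepGraph p) (true : Bool) - canonicalParam g n d (sepGraph p) (true : Bool) :=
      congrFun (congrArg Subtype.val (hC p)) (true : Bool)
    exact sub_eq_zero.2 (sub_left_injective h1)
  · have h1 : φ.1 (loopGraph p) (true : Bool) - canonicalParam g n d (loopGraph p) (true : Bool) =
        φ'.1 (loopGraph p) (true : Bool) - canonicalParam g n d (loopGraph p) (true : Bool) :=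
      congrFun (congrArg Subtype.val (hD p)) (true : Bool)
    exact sub_eq_zero.2 (sub_left_injective h1)

/-- The contribution `c p` of the edge of `Γ(i, S)` to its first vertex, made antisymmetric. -/
def sepCoeff (c : SepIndex g n → ℝ) (w : ℤ) (S : Finset (Fin n)) : ℝ :=
  ∑ p : SepIndex g n, ((if w = 2 * (p.1.1.val : ℤ) - 1 ∧ S = p.1.2 then c p else 0) -
    if 2 * (g : ℤ) - 2 - w = 2 * (p.1.1.val : ℤ) - 1 ∧ Sᶜ = p.1.2 then c p else 0)

theorem sepCoeff_compl (c : SepIndex g n → ℝ) (w : ℤ) (S : Finset (Fin n)) :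
    sepCoeff c (2 * (g : ℤ) - 2 - w) Sᶜ = -sepCoeff c w S := by
  rw [sepCoeff, sepCoeff, ← Finset.sum_neg_distrib]
  refine Finset.sum_congr rfl fun p _ => ?_
  rw [sub_sub_cancel, compl_compl, neg_sub]

/-- The antisymmetrization causes no interference, since an index is never the opposite side of an
index: both first sides contain the marking `1`, or, if `n = 0`, both have genus less than `g / 2`.
-/
theorem sepCoeff_apply (c : SepIndex g n → ℝ) (p : SepIndex g n) :
    sepCoeff c (2 * (p.1.1.val : ℤ) - 1) p.1.2 = c p := by
  rw [sepCoeff, Finset.sum_sub_distrib, Finset.sum_eq_single p, if_pos ⟨rfl, rfl⟩,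
    Finset.sum_eq_zero, sub_zero]
  · rintro q -
    refine if_neg ?_
    rintro ⟨h1, h2⟩
    rcases Nat.eq_zero_or_pos n with hn | hn
    · have h3 := p.2.2.2.1 hn
      have h4 := q.2.2.2.1 hn
      omega
    · have h3 := p.2.2.2.2 hn
      have h4 := q.2.2.2.2 hn
      rw [← h2, Finset.mem_compl] at h4
      exact h4 h3
  · rintro q - hq
    refine if_neg ?_
    rintro ⟨h1, h2⟩
    exact hq (Subtype.ext (Prod.ext (Fin.ext (by omega)) h2.symm))
  · exact fun h => absurd (Finset.mem_univ _) h

theorem canonicalParam_loopGraph (d : ℝ) (j : LoopIndex g n) :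
    canonicalParam g n d (loopGraph j) (true : Bool) = 0 := by
  refine (canonicalParam_vine d (loopGraph j).2).trans ?_
  split_ifs with h1 h2
  · norm_num
  · obtain ⟨h3, h4⟩ := h2
    rw [Finset.mem_singleton] at h4
    have := j.2.2 (by have := j.2.1; omega)
    rw [← h4] at this
    exact absurd rfl this
  · rfl

/-- The degrees `z` on the markings realize the coordinates in `D`, the remaining degree `d - X` is
placed where no `Γ_j` sees it, and the separating terms then adjust the coordinates in `C`. -/
theorem toCD_surjective (hgn : 2 < 2 * g + n) (d : ℝ) [Nonempty (stabSpaceDeg g n d)] :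
    Function.Surjective (toCD g n d) := by
  rintro ⟨γ, ξ⟩
  let X : ℝ := ∑ t : LoopIndex g n, xcoord t ξ
  let z : Fin n → ℝ := fun s => if h : 1 ≤ g ∧ (g = 1 → s.val ≠ 0) then xcoord ⟨s, h⟩ ξ else 0
  -- For `g ≤ 1` the remaining degree sits on the marking `1`; for `g ≥ 2` it is spread by `κ` along
  -- the dualizing degree, which vanishes at the first vertex of `Γ_j`.
  let w : Fin n → ℝ := fun s => if 2 ≤ g then 0 else if s.val = 0 then d - X else 0
  let κ : ℝ := if 2 ≤ g then (d - X) / (2 * g - 2) else 0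
  let c : SepIndex g n → ℝ := fun p => alpha p γ +
    canonicalParam g n d (sepGraph p) (true : Bool) - ∑ s ∈ p.1.2, (z s + w s) -
      κ * (2 * p.1.1.val - 1)
  have hz : ∑ s, z s = X := by
    have h1 : ∀ t : LoopIndex g n, xcoord t ξ = z t.1 := fun t =>
      (dif_pos t.2 : z t.1 = xcoord t ξ).symm
    simp only [X, h1]
    rw [← Finset.sum_subtype (Finset.univ.filter fun s : Fin n => 1 ≤ g ∧ (g = 1 → s.val ≠ 0))
      (by simp) z]
    refine (Finset.sum_filter_of_ne fun s _ hs => ?_).symm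
    by_contra hn
    exact hs (dif_neg hn)
  have hd : ∑ s, (z s + w s) + κ * (2 * g - 2) = d := by
    rw [Finset.sum_add_distrib, hz]
    by_cases hg : 2 ≤ g
    · have : (2 : ℝ) ≤ g := by exact_mod_cast hg
      have : (2 * (g : ℝ) - 2) ≠ 0 := by linarith
      simp only [w, κ, hg, if_true, Finset.sum_const_zero]
      rw [div_mul_cancel₀ _ this]
      ring
    · simp only [w, κ, hg, if_false, zero_mul, add_zero]
      rw [sum_ite_val_eq_zero (by omega)]
      ring
  refine ⟨⟨_, linearParam_mem (g := g) (fun s => z s + w s) κ (sepCoeff_compl c) hd⟩,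
    Prod.ext (funext fun p => degZero_vine_ext ?_) (funext fun t => degZero_vine_ext ?_)⟩
  · change linearParam _ κ _ (vine 1 p.1.1.val (g - p.1.1.val) p.1.2) (true : Bool) -
      canonicalParam g n d (sepGraph p) (true : Bool) = alpha p γ
    rw [vine_linearParam _ _ _ le_rfl, if_pos rfl, sepCoeff_apply]
    simp only [c]
    push_cast
    ring
  · change linearParam _ κ _ (vine 2 0 (g - 1) {t.1}) (true : Bool) -
      canonicalParam g n d (loopGraph t) (true : Bool) = xcoord t ξ
    rw [vine_linearParam _ _ _ one_le_two, if_neg (by decide), canonicalParam_loopGraph]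
    have h1 : z t.1 = xcoord t ξ := dif_pos t.2
    have h2 : w t.1 = 0 := by
      simp only [w]
      split_ifs with h3 h4
      · rfl
      · exact absurd h4 (t.2.2 (by have := t.2.1; omega))
      · rfl
    rw [Finset.sum_singleton, h1, h2]
    push_cast
    ring

theorem nonempty_stabSpaceDeg (hgn : 2 < 2 * g + n) (d : ℝ) : Nonempty (stabSpaceDeg g n d) :=
  ⟨⟨_, canonicalParam_mem hgn d⟩⟩

/-- The isomorphism of affine spaces `(π_C, π_D)`. -/
def equivCD (hgn : 2 < 2 * g + n) (d : ℝ) [Nonempty (stabSpaceDeg g n d)] :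
    stabSpaceDeg g n d ≃ᵃ[ℝ] CSpace g n × DSpace g n :=
  AffineEquiv.ofBijective (φ := toCD g n d) ⟨toCD_injective d, toCD_surjective hgn d⟩

theorem equivCD_apply (hgn : 2 < 2 * g + n) (d : ℝ) [Nonempty (stabSpaceDeg g n d)]
    (φ : stabSpaceDeg g n d) : equivCD hgn d φ = (toC φ, toD φ) := rfl

end UnivStab
end

noncomputable section
namespace UnivStab
open scoped Classical
open MarkedGraph

variable {g n : ℕ}

/-! ### The stability subspaces -/

/-- The stability subspace given by a vine graph. -/
def vineWall (g n : ℕ) (d : ℝ) (α i : ℕ) (S : Finset (Fin n)) (k : ℤ) :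
    Set (stabSpaceDeg g n d) :=
  {φ | vineValue φ.1 α i S = k + (α : ℝ) / 2}

theorem stabSubspace_eq_vineWall (d : ℝ) (Γ : StableGraph g n) {U : Finset Γ.1.Vert}
    (hU : Γ.1.IsElementary U) {α i : ℕ} {S : Finset (Fin n)} (hα : Γ.1.cutSize U = α)
    (hi : Γ.1.omegaSum U = 2 * i - 2 + α) (hS : Γ.1.marks U = S) (k : ℤ) :
    stabSubspace d Γ U k = vineWall g n d α i S k := by
  ext φ
  change (k : ℝ) - ∑ v ∈ U, φ.1 Γ v + (Γ.1.cutSize U : ℝ) / 2 = 0 ↔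
    vineValue φ.1 α i S = k + (α : ℝ) / 2
  rw [← sum_eq_vineValue φ.2.1 Γ hU hα hi hS, hα]
  constructor <;> intro h <;> linarith

theorem stabSubspaces_eq (d : ℝ) : stabSubspaces g n d = {X | ∃ (α i j : ℕ) (S : Finset (Fin n))
    (_ : (vine α i j S).IsStable ∧ (vine α i j S).arithGenus = g) (k : ℤ),
      X = vineWall g n d α i S k} := by
  ext X
  constructor
  · rintro ⟨Γ, U, k, hU, rfl⟩
    obtain ⟨α, i, j, S, h, h1, h2, h3, -⟩ := exists_vine Γ hU
    exact ⟨α, i, j, S, h, k, stabSubspace_eq_vineWall d Γ hU h1 h2 h3 k⟩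
  · rintro ⟨α, i, j, S, h, k, rfl⟩
    have hU := vine_isElementary (i := i) (j := j) (S := S) (one_le_of_vine_isStable h.1) true
    exact ⟨⟨vine α i j S, h⟩, ({true} : Finset Bool), k, hU,
      (stabSubspace_eq_vineWall d ⟨vine α i j S, h⟩ hU (vine_cutSize _ _ _ _ _)
        (by rw [vine_omegaSum]; rfl) (vine_marks _ _ _ _).1 k).symm⟩

/-- The two values add up to `d`, and `d - (k + α/2) = (d - k - α) + α/2`; integrality of `d` makes
the new level an integer. -/
theorem vineWall_compl (d : ℤ) {α i j : ℕ} {S : Finset (Fin n)}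
    (h : (vine α i j S).IsStable ∧ (vine α i j S).arithGenus = g) (k : ℤ) :
    vineWall g n d α i S k = vineWall g n d α j Sᶜ (d - k - α) := by
  ext φ
  have h1 := vineValue_add_compl φ.2 h
  change vineValue φ.1 α i S = k + (α : ℝ) / 2 ↔
    vineValue φ.1 α j Sᶜ = ((d - k - α : ℤ) : ℝ) + (α : ℝ) / 2
  push_cast
  constructor <;> intro h <;> linarith

theorem vine_swap {α i j : ℕ} {S : Finset (Fin n)}
    (h : (vine α i j S).IsStable ∧ (vine α i j S).arithGenus = g) :
    (vine α j i Sᶜ).IsStable ∧ (vine α j i Sᶜ).arithGenus = g := by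
  have h1 := vine_sum_eq h
  have h2 := h.1.vine_left
  have h3 : Sᶜᶜ.card = n - Sᶜ.card := by rw [Finset.card_compl, Fintype.card_fin]
  rw [compl_compl] at h3
  refine ⟨vine_isStable _ _ _ _ (one_le_of_vine_isStable h.1) h.1.vine_right ?_, ?_⟩
  · rwa [← h3]
  · rw [vine_arithGenus]
    omega

/-- For `g ≥ 2`, the canonical value is `(2i - 1)(d + 1 - g)/(2g - 2) + (2i - 1)/2`, which shifts `k
+ 1/2` to `k + 1 - i`. For `g ≤ 1` it is `d`, as the first vertex carries the marking `1`. -/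
theorem vineWall_sep (hgn : 2 < 2 * g + n) (d : ℤ) (p : SepIndex g n) (k : ℤ) :
    vineWall g n d 1 p.1.1.val p.1.2 k =
      toC ⁻¹' wallC (d : ℝ) p (k + 1 - if 2 ≤ g then (p.1.1.val : ℤ) else d) := by
  ext φ
  have h1 : alpha p (toC φ) = vineValue φ.1 1 p.1.1.val p.1.2 -
      canonicalParam g n d (sepGraph p) (true : Bool) := by
    rw [vineValue_sepGraph]
    rfl
  change vineValue φ.1 1 p.1.1.val p.1.2 = k + ((1 : ℕ) : ℝ) / 2 ↔
    alpha p (toC φ) = wallLevelC g d p.1.1.val _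
  rw [h1, show canonicalParam g n d (sepGraph p) (true : Bool) = _ from
    canonicalParam_vine (d : ℝ) (sepGraph p).2, wallLevelC]
  by_cases hg : 2 ≤ g
  · have : (2 : ℝ) ≤ g := by exact_mod_cast hg
    have hne : (2 * (g : ℝ) - 2) ≠ 0 := by linarith
    simp only [hg, if_true]
    push_cast
    have e1 : (d : ℝ) / (2 * g - 2) * (2 * (p.1.1.val : ℝ) - 2 + 1) =
        (2 * (p.1.1.val : ℝ) - 1) * (d + 1 - g) / (2 * g - 2) + (2 * (p.1.1.val : ℝ) - 1) / 2 := by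
      rw [div_mul_eq_mul_div, div_add_div _ _ hne two_ne_zero,
        div_eq_div_iff hne (mul_ne_zero hne two_ne_zero)]
      ring
    rw [e1]
    constructor <;> intro h <;> linarith
  · have hn : 0 < n := by omega
    have h2 : ∃ h : 0 < n, (⟨0, h⟩ : Fin n) ∈ p.1.2 := ⟨hn, p.2.2.2.2 hn⟩
    simp only [hg, if_false, h2, if_true]
    push_cast
    constructor <;> intro h <;> linarith

/-- With `ℓ = 2i + α - 2`, passing from `d` to `d + 1 - g` subtracts `ℓ/2` from the value, and `k +
α/2 - ℓ/2 = k + 1 - i`. The formula for the value is a hypothesis because the symmetric vine with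
one edge satisfies it too. -/
theorem vineWall_nonsep (hg : 1 ≤ g) (d : ℤ) {α i : ℕ} {T : Finset (LoopIndex g n)}
    (hi : 2 ≤ 2 * i + α) (hg1 : g = 1 → 2 * i + α = 2)
    (hval : ∀ φ ∈ stabSpaceDeg g n d, vineValue φ α i (loopMarks T) =
      ∑ t ∈ T, φ (loopGraph t) (true : Bool) +
      (2 * i - 2 + α) * (d - ∑ t : LoopIndex g n, φ (loopGraph t) (true : Bool)) /
        (2 * g - 2 + delta g)) (k : ℤ) :
    vineWall g n d α i (loopMarks T) k = toD ⁻¹' wallD (d : ℝ) (2 * i + α - 2) T (k + 1 - i) := by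
  ext φ
  have h1 : ∀ t, xcoord t (toD φ) = φ.1 (loopGraph t) (true : Bool) := fun t =>
    (congrArg (φ.1 (loopGraph t) (true : Bool) - ·) (canonicalParam_loopGraph (d : ℝ) t)).trans
      (sub_zero _)
  change vineValue φ.1 α i (loopMarks T) = k + (α : ℝ) / 2 ↔
    wallFunD d (2 * i + α - 2) T (toD φ) = ((k + 1 - i : ℤ) : ℝ)
  rw [hval φ.1 φ.2, wallFunD]
  simp only [h1]
  have hpos := twice_genus_delta_pos hg
  have hl : ((2 * i + α - 2 : ℕ) : ℝ) = 2 * i - 2 + α := by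
    rw [Nat.cast_sub hi]
    push_cast
    ring
  have h2 : (2 * (i : ℝ) - 2 + α) * (g - 1) / (2 * g - 2 + delta g) = (2 * i - 2 + α) / 2 := by
    rw [div_eq_div_iff hpos.ne' two_ne_zero]
    by_cases h : g = 1
    · have : (2 * (i : ℝ) + α) = 2 := by exact_mod_cast hg1 h
      have : (2 * (i : ℝ) - 2 + α) = 0 := by linarith
      rw [this]
      ring
    · rw [delta, if_neg h, Nat.cast_zero]
      ring
  rw [hl]
  set X := ∑ t : LoopIndex g n, φ.1 (loopGraph t) (true : Bool)
  have h3 : (2 * (i : ℝ) - 2 + α) * (d + 1 - g - X) / (2 * g - 2 + delta g) =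
      (2 * (i : ℝ) - 2 + α) * (d - X) / (2 * g - 2 + delta g) - (2 * i - 2 + α) / 2 := by
    rw [← h2, ← sub_div]
    ring
  rw [h3]
  push_cast
  constructor <;> intro h <;> linarith

theorem vineWall_loopMarks (d : ℤ) {α i j : ℕ} (hα : 2 ≤ α) {T : Finset (LoopIndex g n)}
    (h : (vine α i j (loopMarks T)).IsStable ∧ (vine α i j (loopMarks T)).arithGenus = g) (k : ℤ) :
    vineWall g n d α i (loopMarks T) k = toD ⁻¹' wallD (d : ℝ) (2 * i + α - 2) T (k + 1 - i) := by
  have h1 := vine_sum_eq h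
  exact vineWall_nonsep (by omega) d (by omega) (by omega)
    (fun φ hφ => vineValue_loopMarks hφ hα T h) k

theorem vineWall_mem_walls (hgn : 2 < 2 * g + n) (d : ℤ) {α i j : ℕ} {S : Finset (Fin n)}
    (h : (vine α i j S).IsStable ∧ (vine α i j S).arithGenus = g) (k : ℤ) :
    vineWall g n d α i S k ∈ {X : Set (stabSpaceDeg g n d) | ∃ W ∈ wallsC g n d, X = toC ⁻¹' W} ∪
      {X | ∃ W ∈ wallsD g n d, X = toD ⁻¹' W} := by
  have h0 := vine_sum_eq h
  by_cases hα : 2 ≤ α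
  · right
    have key : ∀ (i j : ℕ) (T : Finset (LoopIndex g n)) (k : ℤ)
        (_ : (vine α i j (loopMarks T)).IsStable ∧ (vine α i j (loopMarks T)).arithGenus = g)
        (_ : (2 * i + α : ℤ) < 2 * g + delta g) (_ : ¬ (2 * i + α = 2 ∧ T = ∅)),
        ∃ W ∈ wallsD g n d, vineWall g n d α i (loopMarks T) k = toD ⁻¹' W := by
      intro i j T k h h1 h2
      refine ⟨_, ⟨2 * i + α - 2, T, k + 1 - i, by omega, fun h3 => h2 ⟨by omega, h3.2⟩, rfl⟩,
        vineWall_loopMarks d hα h k⟩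
    rcases loopIndex_cases hα h with ⟨T, rfl, h1, h2⟩ | ⟨T, hT, h1, h2⟩
    · exact key i j T k h h1 h2
    · rw [vineWall_compl d h]
      have h' := vine_swap h
      rw [← hT] at h' ⊢
      exact key j i T _ h' h1 h2
  · obtain rfl : α = 1 := by
      have := one_le_of_vine_isStable h.1
      omega
    rcases sepIndex_cases h with ⟨p, rfl, rfl⟩ | ⟨p, rfl, hp⟩ | ⟨hn, hij⟩
    · exact Or.inl ⟨_, ⟨p, _, rfl⟩, vineWall_sep hgn d p k⟩
    · rw [vineWall_compl d h, ← hp]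
      exact Or.inl ⟨_, ⟨p, _, rfl⟩, vineWall_sep hgn d p _⟩
    -- The vine with one edge and two vertices of genus `g/2` has constant value `d/2` by symmetry.
    -- Its subspace is everything or empty, and agrees with the wall in `D` for `ℓ = g - 1` and `S =
    -- ∅`.
    · subst hn hij
      right
      have hS : S = loopMarks (∅ : Finset (LoopIndex g 0)) := Subsingleton.elim _ _
      refine ⟨_, ⟨2 * i + 1 - 2, ∅, k + 1 - i, by omega, fun h3 => by omega, rfl⟩, ?_⟩
      rw [hS]
      refine vineWall_nonsep (by omega) d (by omega) (by omega) (fun φ hφ => ?_) k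
      have h1 := vineValue_add_compl hφ h
      rw [Subsingleton.elim Sᶜ S, hS] at h1
      have h2 : vineValue φ 1 i (loopMarks (∅ : Finset (LoopIndex g 0))) = d / 2 := by linarith
      have hg : (2 : ℝ) * i = g := by
        have : 2 * i = g := by omega
        exact_mod_cast this
      have hpos := twice_genus_delta_pos (g := g) (by omega)
      rw [delta, if_neg (by omega : ¬ g = 1), Nat.cast_zero, add_zero] at hpos ⊢
      have hemp : (Finset.univ : Finset (LoopIndex g 0)) = ∅ := by
        ext t
        exact t.1.elim0
      rw [h2, hemp, Finset.sum_empty, hg, sub_zero, zero_add, Nat.cast_one,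
        div_eq_div_iff two_ne_zero hpos.ne']
      ring

theorem stabSubspaces_eq_walls (hgn : 2 < 2 * g + n) (d : ℤ) :
    stabSubspaces g n d =
      {X | ∃ W ∈ wallsC g n d, X = toC ⁻¹' W} ∪ {X | ∃ W ∈ wallsD g n d, X = toD ⁻¹' W} := by
  rw [stabSubspaces_eq]
  refine Set.Subset.antisymm ?_ (Set.union_subset ?_ ?_)
  · rintro X ⟨α, i, j, S, h, k, rfl⟩
    exact vineWall_mem_walls hgn d h k
  · rintro X ⟨_, ⟨p, k, rfl⟩, rfl⟩
    refine ⟨1, p.1.1.val, g - p.1.1.val, p.1.2, (sepGraph p).2,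
      k - 1 + if 2 ≤ g then (p.1.1.val : ℤ) else d, ?_⟩
    rw [vineWall_sep hgn]
    congr 2
    ring
  · rintro X ⟨_, ⟨l, T, k, hl, hlT, rfl⟩, rfl⟩
    have hδ : delta g ≤ 1 ∧ (delta g = 1 → g = 1) := by
      rw [delta]
      split_ifs with h <;> simp [h]
    have hg : 1 ≤ g := by omega
    have hT : l = 0 → 1 ≤ (loopMarks T).card := fun h => by
      rw [loopMarks, Finset.card_map, Nat.one_le_iff_ne_zero, Ne, Finset.card_eq_zero]
      exact fun hT => hlT ⟨h, hT⟩
    have key : ∀ (α i j : ℕ) (_ : 2 ≤ α) (_ : 2 * i + α - 2 = l)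
        (_ : (vine α i j (loopMarks T)).IsStable ∧ (vine α i j (loopMarks T)).arithGenus = g),
        ∃ (α i j : ℕ) (S : Finset (Fin n))
          (_ : (vine α i j S).IsStable ∧ (vine α i j S).arithGenus = g) (k' : ℤ),
            toD ⁻¹' wallD (d : ℝ) l T k = vineWall g n d α i S k' := by
      intro α i j hα hl h
      refine ⟨α, i, j, loopMarks T, h, k - 1 + i, ?_⟩
      rw [vineWall_loopMarks d hα h, hl]
      congr 2
      ring
    -- Since `ℓ = 2i + α - 2`, two edges realize even `ℓ` and three edges odd `ℓ`.
    by_cases hodd : l % 2 = 0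
    · refine key 2 (l / 2) (g - 1 - l / 2) le_rfl (by omega) ⟨vine_isStable _ _ _ _ (by norm_num)
        (fun h => ?_) (fun h => ?_), ?_⟩
      · have := hT (by omega)
        omega
      · by_cases hg1 : g = 1
        · have h1 := hT (by omega)
          have hn : 0 < n := h1.trans ((Finset.card_le_univ _).trans (Fintype.card_fin n).le)
          -- In genus one the second vertex also has genus zero; it is stable because it carries the
          -- marking `1`.
          have h2 : (⟨0, hn⟩ : Fin n) ∈ (loopMarks T)ᶜ := by
            rw [Finset.mem_compl, loopMarks, Finset.mem_map]
            rintro ⟨t, -, ht⟩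
            exact t.2.2 hg1 (congrArg Fin.val ht)
          have h3 : 1 ≤ (loopMarks T)ᶜ.card := Finset.card_pos.2 ⟨_, h2⟩
          rw [Finset.card_compl, Fintype.card_fin] at h3
          omega
        · omega
      · rw [vine_arithGenus]
        omega
    · refine key 3 ((l - 1) / 2) (g - 2 - (l - 1) / 2) (by norm_num) (by omega)
        ⟨vine_isStable _ _ _ _ (by norm_num) (fun h => by omega) (fun h => by omega), ?_⟩
      rw [vine_arithGenus]
      omega

end UnivStab
end

noncomputable section
namespace UnivStab
open scoped Classical
open MarkedGraph

/-! ### Chambers -/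

/-- The chambers of an arrangement of integer levels of affine functions. -/
theorem connectedComponentIn_integer_levels {E ι : Type*} [AddCommGroup E] [Module ℝ E]
    [TopologicalSpace E] [ContinuousAdd E] [ContinuousSMul ℝ E] {f : ι → E →ᵃ[ℝ] ℝ}
    (hf : ∀ i, Continuous (f i)) {A : Set (Set E)}
    (hA : ∀ X, X ∈ A ↔ ∃ (i : ι) (k : ℤ), X = {x | f i x = k}) {x : E} (hx : x ∈ (⋃₀ A)ᶜ) :
    connectedComponentIn (⋃₀ A)ᶜ x =
      {y | ∀ i, (⌊f i x⌋ : ℝ) < f i y ∧ f i y < (⌊f i x⌋ : ℝ) + 1} := by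
  have hmem : ∀ y, y ∈ (⋃₀ A)ᶜ ↔ ∀ i (k : ℤ), f i y ≠ k := by
    intro y
    rw [Set.mem_compl_iff, Set.mem_sUnion]
    constructor
    · exact fun h i k hk => h ⟨_, (hA _).2 ⟨i, k, rfl⟩, hk⟩
    · rintro h ⟨_, hX, hy⟩
      obtain ⟨i, k, rfl⟩ := (hA _).1 hX
      exact h i k hy
  refine Set.Subset.antisymm (fun y hy i => ?_) (IsPreconnected.subset_connectedComponentIn
    ?_ (fun i => ?_) fun y hy => (hmem y).2 fun i k hk => ?_)
  -- The image of the component under `f i` is an interval without integers, so it stays between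
  -- consecutive integers. No local finiteness of the arrangement is needed.
  · have hord := ((isPreconnected_connectedComponentIn (x := x) (F := (⋃₀ A)ᶜ)).image (f i)
      (hf i).continuousOn).ordConnected
    have hxm : f i x ∈ f i '' connectedComponentIn (⋃₀ A)ᶜ x :=
      ⟨x, mem_connectedComponentIn hx, rfl⟩
    have hym : f i y ∈ f i '' connectedComponentIn (⋃₀ A)ᶜ x := ⟨y, hy, rfl⟩
    have hno : ∀ k : ℤ, (k : ℝ) ∉ f i '' connectedComponentIn (⋃₀ A)ᶜ x := by
      rintro k ⟨z, hz, hzk⟩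
      exact (hmem z).1 (connectedComponentIn_subset _ _ hz) i k hzk
    constructor
    · by_contra hlt
      exact hno ⌊f i x⌋ (hord.out hym hxm ⟨not_lt.1 hlt, Int.floor_le _⟩)
    · by_contra hlt
      refine hno (⌊f i x⌋ + 1) (hord.out hxm hym ?_)
      push_cast
      exact ⟨(Int.lt_floor_add_one _).le, not_lt.1 hlt⟩
  -- Conversely the cell is convex, contains `x` and meets no wall.
  · refine Convex.isPreconnected ?_
    have : {y | ∀ i, (⌊f i x⌋ : ℝ) < f i y ∧ f i y < (⌊f i x⌋ : ℝ) + 1} =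
        ⋂ i, f i ⁻¹' Set.Ioo (⌊f i x⌋ : ℝ) ((⌊f i x⌋ : ℝ) + 1) := by
      ext y
      simp
    rw [this]
    exact convex_iInter fun i => (convex_Ioo _ _).affine_preimage (f i)
  · exact ⟨lt_of_le_of_ne (Int.floor_le _) ((hmem x).1 hx i _).symm, Int.lt_floor_add_one _⟩
  · have h1 := hy i
    rw [hk] at h1
    have h2 : ⌊f i x⌋ < k := by exact_mod_cast h1.1
    have h3 : k < ⌊f i x⌋ + 1 := by exact_mod_cast h1.2
    omega

theorem continuous_of_eq_linear_add {E : Type*} [AddCommGroup E] [Module ℝ E] [TopologicalSpace E]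
    [IsTopologicalAddGroup E] [ContinuousSMul ℝ E] [T2Space E] [FiniteDimensional ℝ E]
    (f : E → ℝ) (L : E →ₗ[ℝ] ℝ) (c : ℝ) (h : ∀ x, f x = L x + c) : Continuous f := by
  rw [funext h]
  exact L.continuous_of_finiteDimensional.add continuous_const

theorem connectedComponentIn_prod {X Y : Type*} [TopologicalSpace X] [TopologicalSpace Y]
    {s : Set X} {t : Set Y} {a : X} {b : Y} (ha : a ∈ s) (hb : b ∈ t) :
    connectedComponentIn (s ×ˢ t) (a, b) = connectedComponentIn s a ×ˢ connectedComponentIn t b := by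
  refine Set.Subset.antisymm (fun p hp => ?_) ?_
  · have h1 := isPreconnected_connectedComponentIn (x := (a, b)) (F := s ×ˢ t)
    have h2 := connectedComponentIn_subset (s ×ˢ t) (a, b)
    have h3 := mem_connectedComponentIn (F := s ×ˢ t) (x := (a, b)) ⟨ha, hb⟩
    constructor
    · refine (h1.image Prod.fst continuous_fst.continuousOn).subset_connectedComponentIn
        ⟨_, h3, rfl⟩ ?_ ⟨p, hp, rfl⟩
      rintro _ ⟨q, hq, rfl⟩
      exact (h2 hq).1
    · refine (h1.image Prod.snd continuous_snd.continuousOn).subset_connectedComponentIn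
        ⟨_, h3, rfl⟩ ?_ ⟨p, hp, rfl⟩
      rintro _ ⟨q, hq, rfl⟩
      exact (h2 hq).2
  · exact (isPreconnected_connectedComponentIn.prod
      isPreconnected_connectedComponentIn).subset_connectedComponentIn
      ⟨mem_connectedComponentIn ha, mem_connectedComponentIn hb⟩
      (Set.prod_mono (connectedComponentIn_subset _ _) (connectedComponentIn_subset _ _))

/-- The chambers of a product arrangement. -/
theorem chambers_prod {V X Y : Type*} [TopologicalSpace V] [TopologicalSpace X]
    [TopologicalSpace Y] (e : V ≃ₜ X × Y) (A : Set (Set X)) (B : Set (Set Y)) :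
    chambers ({Z | ∃ W ∈ A, Z = (fun v => (e v).1) ⁻¹' W} ∪
        {Z | ∃ W ∈ B, Z = (fun v => (e v).2) ⁻¹' W}) =
      {P | ∃ Q ∈ chambers A, ∃ R ∈ chambers B, P = {v | (e v).1 ∈ Q ∧ (e v).2 ∈ R}} := by
  set F : Set (Set V) := {Z | ∃ W ∈ A, Z = (fun v => (e v).1) ⁻¹' W} ∪
        {Z | ∃ W ∈ B, Z = (fun v => (e v).2) ⁻¹' W} with hF
  have hcompl : (⋃₀ F)ᶜ = e ⁻¹' ((⋃₀ A)ᶜ ×ˢ (⋃₀ B)ᶜ) := by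
    ext v
    simp only [Set.mem_compl_iff, Set.mem_preimage, Set.mem_prod, Set.mem_sUnion]
    constructor
    · exact fun h => ⟨fun ⟨W, hW, hv⟩ => h ⟨_, Or.inl ⟨W, hW, rfl⟩, hv⟩,
        fun ⟨W, hW, hv⟩ => h ⟨_, Or.inr ⟨W, hW, rfl⟩, hv⟩⟩
    · rintro ⟨h1, h2⟩ ⟨_, ⟨W, hW, rfl⟩ | ⟨W, hW, rfl⟩, hv⟩
      · exact h1 ⟨W, hW, hv⟩
      · exact h2 ⟨W, hW, hv⟩
  have hcomp : ∀ v ∈ (⋃₀ F)ᶜ, connectedComponentIn (⋃₀ F)ᶜ v =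
      {u | (e u).1 ∈ connectedComponentIn (⋃₀ A)ᶜ (e v).1 ∧
        (e u).2 ∈ connectedComponentIn (⋃₀ B)ᶜ (e v).2} := by
    intro v hv
    have h1 := e.image_connectedComponentIn hv
    rw [hcompl] at hv
    have h2 : e '' (⋃₀ F)ᶜ = (⋃₀ A)ᶜ ×ˢ (⋃₀ B)ᶜ := by
      rw [hcompl, Set.image_preimage_eq _ e.surjective]
    rw [h2, ← Prod.mk.eta (p := e v), connectedComponentIn_prod hv.1 hv.2] at h1
    rw [← e.injective.preimage_image (connectedComponentIn (⋃₀ F)ᶜ v), h1]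
    rfl
  ext P
  constructor
  · rintro ⟨v, hv, rfl⟩
    have hv' := hv
    rw [hcompl] at hv'
    exact ⟨_, ⟨_, hv'.1, rfl⟩, _, ⟨_, hv'.2, rfl⟩, hcomp v hv⟩
  · rintro ⟨_, ⟨x, hx, rfl⟩, _, ⟨y, hy, rfl⟩, rfl⟩
    obtain ⟨v, hv⟩ := e.surjective (x, y)
    have hvF : v ∈ (⋃₀ F)ᶜ := by
      rw [hcompl, Set.mem_preimage, hv]
      exact ⟨hx, hy⟩
    refine ⟨v, hvF, ?_⟩
    rw [hcomp v hvF, hv]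

/-! ### The arrangements in `C` and `D` as integer levels of affine functions -/

variable {g n : ℕ}

/-- The coordinate `α_{i,S}` as a linear form. -/
def alphaLinear (p : SepIndex g n) : CSpace g n →ₗ[ℝ] ℝ where
  toFun := alpha p
  map_add' _ _ := rfl
  map_smul' _ _ := rfl

/-- The coordinate `x_j` as a linear form. -/
def xcoordLinear (j : LoopIndex g n) : DSpace g n →ₗ[ℝ] ℝ where
  toFun := xcoord j
  map_add' _ _ := rfl
  map_smul' _ _ := rfl

theorem wallLevelC_eq (d : ℝ) (i : ℕ) (k : ℤ) :
    wallLevelC g d i k = wallLevelC g d i 0 + k := by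
  rw [wallLevelC, wallLevelC]
  split_ifs <;> push_cast <;> ring

/-- The affine function whose integer levels are the `W_C(i, S, k)`. -/
def wallAffineC (d : ℝ) (p : SepIndex g n) : CSpace g n →ᵃ[ℝ] ℝ :=
  (alphaLinear p).toAffineMap + AffineMap.const ℝ _ (-wallLevelC g d p.1.1.val 0)

theorem wallAffineC_apply (d : ℝ) (p : SepIndex g n) (ψ : CSpace g n) :
    wallAffineC d p ψ = alpha p ψ - wallLevelC g d p.1.1.val 0 := by
  rw [sub_eq_add_neg]
  rfl

/-- The left-hand side of the equation of `W_D(ℓ, S, k)` as an affine function. -/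
def wallAffineD (d : ℝ) (l : ℕ) (S : Finset (LoopIndex g n)) : DSpace g n →ᵃ[ℝ] ℝ :=
  (∑ j ∈ S, xcoordLinear j - ((l : ℝ) / (2 * g - 2 + delta g)) •
    ∑ j : LoopIndex g n, xcoordLinear j).toAffineMap +
      AffineMap.const ℝ _ (l * (d + 1 - g) / (2 * g - 2 + delta g))

theorem wallAffineD_apply (d : ℝ) (l : ℕ) (S : Finset (LoopIndex g n)) (x : DSpace g n) :
    wallAffineD d l S x = wallFunD d l S x := by
  have h1 : ∀ T : Finset (LoopIndex g n), (∑ j ∈ T, xcoordLinear j) x = ∑ j ∈ T, xcoord j x :=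
    fun T => LinearMap.sum_apply _ _ _
  simp only [wallAffineD, wallFunD, AffineMap.coe_add, LinearMap.coe_toAffineMap, Pi.add_apply,
    LinearMap.sub_apply, LinearMap.smul_apply, h1, AffineMap.const_apply, smul_eq_mul]
  ring

theorem chambers_wallsC (d : ℝ) : chambers (wallsC g n d) = unitCubesC g n d := by
  have hA : ∀ X, X ∈ wallsC g n d ↔ ∃ (p : SepIndex g n) (k : ℤ),
      X = {ψ | wallAffineC d p ψ = k} := by
    intro X
    refine exists_congr fun p => exists_congr fun k => ?_
    have : wallC d p k = {ψ | wallAffineC d p ψ = k} := by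
      ext ψ
      change alpha p ψ = wallLevelC g d p.1.1.val k ↔ wallAffineC d p ψ = k
      rw [wallAffineC_apply, wallLevelC_eq]
      constructor <;> intro h <;> linarith
    rw [this]
  have hcomp := fun ψ (hψ : ψ ∈ (⋃₀ wallsC g n d)ᶜ) => connectedComponentIn_integer_levels
    (fun p => continuous_of_eq_linear_add _ (alphaLinear p) _ fun _ => rfl) hA hψ
  ext Q
  constructor
  · rintro ⟨ψ, hψ, rfl⟩
    refine ⟨fun p => ⌊wallAffineC d p ψ⌋, ?_⟩
    rw [hcomp ψ hψ]
    ext y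
    refine forall_congr' fun p => ?_
    have h0 := wallLevelC_eq (g := g) d p.1.1.val ⌊wallAffineC d p ψ⌋
    rw [wallAffineC_apply d p y]
    dsimp only
    rw [h0]
    constructor <;> rintro ⟨h1, h2⟩ <;> constructor <;> linarith
  · rintro ⟨m, rfl⟩
    -- The centre of the cube, which shows that every choice of integers `m` gives a chamber.
    let ψ : CSpace g n := fun p =>
      ⟨fun b : Bool => if b then wallLevelC g d p.1.1.val (m p) + 1 / 2
        else -(wallLevelC g d p.1.1.val (m p) + 1 / 2),
        (Fintype.sum_bool _).trans (by simp)⟩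
    have h1 : ∀ p, wallAffineC d p ψ = m p + 1 / 2 := by
      intro p
      rw [wallAffineC_apply, show alpha p ψ = wallLevelC g d p.1.1.val (m p) + 1 / 2 from rfl,
        wallLevelC_eq]
      ring
    have hfl : ∀ p, ⌊wallAffineC d p ψ⌋ = m p := by
      intro p
      rw [h1, Int.floor_eq_iff]
      constructor <;> norm_num
    have hψ : ψ ∈ (⋃₀ wallsC g n d)ᶜ := by
      rintro ⟨X, hX, hx⟩
      obtain ⟨p, k, rfl⟩ := (hA X).1 hX
      have h2 : wallAffineC d p ψ = k := hx
      have h3 := hfl p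
      rw [h2, Int.floor_intCast] at h3
      rw [h1, h3] at h2
      linarith
    refine ⟨ψ, hψ, ?_⟩
    rw [hcomp ψ hψ]
    ext y
    refine forall_congr' fun p => ?_
    rw [wallAffineC_apply d p y, wallLevelC_eq, hfl]
    constructor <;> rintro ⟨h1, h2⟩ <;> constructor <;> linarith

theorem norm_degZero_vine {α i j : ℕ} {S : Finset (Fin n)} (a : (vine α i j S).degZero) :
    ‖a‖ = |a.1 (true : Bool)| := by
  have ha : a.1 (true : Bool) + a.1 (false : Bool) = 0 :=
    (Fintype.sum_bool (fun v : Bool => a.1 v)).symm.trans a.2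
  have h1 : a.1 (false : Bool) = -a.1 (true : Bool) := by linarith
  refine le_antisymm ((pi_norm_le_iff_of_nonneg (abs_nonneg _)).2 ?_)
    (norm_le_pi_norm a.1 (true : Bool))
  change ∀ v : Bool, ‖a.1 v‖ ≤ |a.1 (true : Bool)|
  rintro (_ | _)
  · rw [h1, norm_neg, Real.norm_eq_abs]
  · exact le_rfl

/-- Only finitely many pairs `(ℓ, S)` occur, and each gives two strict inequalities on a cell. The
pairs `(0, {j})` confine every coordinate `x_j` between consecutive integers, which gives
boundedness. -/
theorem isOpenPolytope_of_mem_chambers (d : ℝ) {R : Set (DSpace g n)}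
    (hR : R ∈ chambers (wallsD g n d)) : IsOpenPolytope R := by
  let ι : Type := {q : ℕ × Finset (LoopIndex g n) //
    (q.1 : ℤ) < 2 * g - 2 + delta g ∧ ¬ (q.1 = 0 ∧ q.2 = ∅)}
  have hδ : delta g ≤ 1 := by
    rw [delta]
    split_ifs <;> simp
  have hfin : Finite ι := Finite.of_injective
    (fun q : ι => ((⟨q.1.1, by have := q.2.1; omega⟩ : Fin (2 * g + 1)), q.1.2)) (by
      rintro ⟨⟨a, b⟩, h⟩ ⟨⟨a', b'⟩, h'⟩ hq
      simp only [Prod.mk.injEq, Fin.mk.injEq] at hq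
      exact Subtype.ext (Prod.ext hq.1 hq.2))
  have : Fintype ι := Fintype.ofFinite ι
  let f : ι → DSpace g n →ᵃ[ℝ] ℝ := fun q => wallAffineD d q.1.1 q.1.2
  have hA : ∀ X, X ∈ wallsD g n d ↔ ∃ (q : ι) (k : ℤ), X = {x | f q x = k} := by
    intro X
    have h1 : ∀ l S (k : ℤ), wallD d l S k = {x : DSpace g n | wallAffineD d l S x = k} :=
      fun l S k => by
        ext x
        change wallFunD d l S x = k ↔ wallAffineD d l S x = k
        rw [wallAffineD_apply]
    constructor
    · rintro ⟨l, S, k, hl, hlS, rfl⟩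
      exact ⟨⟨(l, S), hl, hlS⟩, k, h1 l S k⟩
    · rintro ⟨⟨⟨l, S⟩, hl, hlS⟩, k, rfl⟩
      exact ⟨l, S, k, hl, hlS, (h1 l S k).symm⟩
  obtain ⟨x, hx, rfl⟩ := hR
  rw [connectedComponentIn_integer_levels (fun q =>
    continuous_of_eq_linear_add _ (f q).linear (f q 0) fun x =>
      (congrArg (f q) (show x +ᵥ (0 : DSpace g n) = x from add_zero x)).symm.trans
        ((f q).map_vadd 0 x)) hA hx]
  refine ⟨isBounded_iff_forall_norm_le.2
    ⟨∑ j : LoopIndex g n, (|(⌊xcoord j x⌋ : ℝ)| + 1), fun y hy => ?_⟩, ?_⟩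
  · have hnn : ∀ j : LoopIndex g n, 0 ≤ |(⌊xcoord j x⌋ : ℝ)| + 1 := fun j => by positivity
    refine (pi_norm_le_iff_of_nonneg (Finset.sum_nonneg fun j _ => hnn j)).2 fun j => ?_
    refine le_trans ?_ (Finset.single_le_sum (fun j _ => hnn j) (Finset.mem_univ j))
    have hq : ((0 : ℕ) : ℤ) < 2 * g - 2 + delta g ∧ ¬ ((0 : ℕ) = 0 ∧ ({j} : Finset (LoopIndex g n)) = ∅) := by
      refine ⟨?_, fun h => Finset.singleton_ne_empty j h.2⟩
      have h1 := j.2.1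
      rw [delta]
      split_ifs <;> push_cast <;> omega
    have h1 : ∀ z, f ⟨(0, {j}), hq⟩ z = xcoord j z := fun z => by
      refine (wallAffineD_apply d 0 {j} z).trans ?_
      simp [wallFunD]
    have h2 := hy ⟨(0, {j}), hq⟩
    rw [h1, h1] at h2
    rw [show ‖y j‖ = |xcoord j y| from norm_degZero_vine (y j), abs_le]
    have h3 := neg_abs_le (⌊xcoord j x⌋ : ℝ)
    have h4 := le_abs_self (⌊xcoord j x⌋ : ℝ)
    constructor <;> linarith
  · refine ⟨(Finset.univ.image fun q => f q + AffineMap.const ℝ _ (-(⌊f q x⌋ : ℝ))) ∪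
      (Finset.univ.image fun q => AffineMap.const ℝ _ ((⌊f q x⌋ : ℝ) + 1) - f q), ?_⟩
    ext y
    simp only [Set.mem_ofPred_eq, Finset.mem_union, Finset.mem_image, Finset.mem_univ, true_and]
    constructor
    · rintro h _ (⟨q, rfl⟩ | ⟨q, rfl⟩)
      · have := (h q).1
        simp only [AffineMap.coe_add, Pi.add_apply, AffineMap.const_apply]
        linarith
      · have := (h q).2
        simp only [AffineMap.coe_sub, Pi.sub_apply, AffineMap.const_apply]
        linarith
    · intro h q
      have h1 := h _ (Or.inl ⟨q, rfl⟩)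
      have h2 := h _ (Or.inr ⟨q, rfl⟩)
      simp only [AffineMap.coe_add, AffineMap.coe_sub, Pi.add_apply, Pi.sub_apply,
        AffineMap.const_apply] at h1 h2
      constructor <;> linarith

/-- The isomorphism `(π_C, π_D)` is a homeomorphism for the topology of pointwise convergence. -/
def homeoCD (hgn : 2 < 2 * g + n) (d : ℝ) [Nonempty (stabSpaceDeg g n d)] :
    stabSpaceDeg g n d ≃ₜ CSpace g n × DSpace g n where
  toEquiv := (equivCD hgn d).toEquiv
  continuous_toFun := by
    have h : ∀ (Γ : StableGraph g n), Continuous fun φ : stabSpaceDeg g n d =>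
        φ.1 Γ - canonicalParam g n d Γ := fun Γ =>
      ((continuous_apply Γ).comp continuous_subtype_val).sub continuous_const
    exact (continuous_pi fun p => (h (sepGraph p)).subtype_mk _).prodMk
      (continuous_pi fun p => (h (loopGraph p)).subtype_mk _)
  -- Each evaluation of the inverse is an affine function on a finite-dimensional space, hence
  -- continuous; this suffices for pointwise convergence.
  continuous_invFun := by
    refine continuous_induced_rng.2 (continuous_pi fun Γ => continuous_pi fun v => ?_)
    let ev : Family g n →ₗ[ℝ] ℝ :=
      { toFun := fun φ => φ Γ v
        map_add' := fun _ _ => rfl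
        map_smul' := fun _ _ => rfl }
    let F := ev.toAffineMap.comp ((stabSpaceDeg g n d).subtype.comp
      (equivCD hgn d).symm.toAffineMap)
    exact continuous_of_eq_linear_add _ F.linear (F 0) fun x =>
      (congrArg F (show x +ᵥ (0 : CSpace g n × DSpace g n) = x from add_zero x)).symm.trans (F.map_vadd 0 x)

end UnivStab
end

/-! ### The theorem -/

open UnivStab
theorem theorem5p10 (g n : ℕ) (hgn : 2 < 2 * g + n) (d : ℤ) :
    -- The canonical parameter lies in `V^d_{g,n}`, and the projections form an affine
    -- isomorphism from `V^d_{g,n}` to `C_{g,n} ⊕ D_{g,n}`.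
    canonicalParam g n d ∈ stabSpaceDeg g n d ∧
    (∃ _ : Nonempty (stabSpaceDeg g n d),
      ∃ e : stabSpaceDeg g n d ≃ᵃ[ℝ] CSpace g n × DSpace g n, ∀ φ, e φ = (toC φ, toD φ)) ∧
    -- The stability subspaces are exactly the pullbacks of the two families.
    stabSubspaces g n d =
      {X | ∃ W ∈ wallsC g n d, X = toC ⁻¹' W} ∪ {X | ∃ W ∈ wallsD g n d, X = toD ⁻¹' W} ∧
    -- The stability polytopes are exactly the products of an open unit hypercube in `C_{g,n}` and
    -- of a chamber of the arrangement in `D_{g,n}`, and these chambers are polytopes.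
    stabPolytopes g n d =
      {P | ∃ Q ∈ unitCubesC g n d, ∃ R ∈ chambers (wallsD g n d),
        P = {φ | toC φ ∈ Q ∧ toD φ ∈ R}} ∧
    (∀ R ∈ chambers (wallsD g n d), IsOpenPolytope R) ∧
    -- The arrangement in `D_{g,n}` contains the integer translates of the resonance hyperplanes.
    (1 ≤ g → ∀ (S : Finset (LoopIndex g n)) (k : ℤ), S.Nonempty →
      {x : DSpace g n | ∑ j ∈ S, xcoord j x = k} ∈ wallsD g n d) := by
  have hne := nonempty_stabSpaceDeg hgn (d : ℝ)
  refine ⟨canonicalParam_mem hgn d, ⟨hne, equivCD hgn d, equivCD_apply hgn d⟩,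
    stabSubspaces_eq_walls hgn d, ?_, fun R hR => isOpenPolytope_of_mem_chambers d hR,
    fun hg S k hS => ?_⟩
  · rw [stabPolytopes, stabSubspaces_eq_walls hgn, ← chambers_wallsC]
    exact chambers_prod (homeoCD hgn (d : ℝ)) _ _
  -- The translates of the resonance hyperplanes are the walls with `ℓ = 0`.
  · refine ⟨0, S, k, ?_, fun h => hS.ne_empty h.2, ?_⟩
    · rw [delta]
      split_ifs <;> push_cast <;> omega
    · ext x
      simp [wallD, wallFunD]
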